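/- Fix an integer $p\ge 2$ and let $|\cdot|$ denote the $L^1$ norm of vectors and matrices (the sum of the absolute values of the entries). For each $n\ge 0$ and $1\le i\le p$ let $g_n^{(i)}$ be a probability distribution on $\mathbb N^p$ (identified with its generating function), put $g_n=(g_n^{(i)})_{1\le i\le p}$ and $\mathbf g=(g_n)_{n\ge 0}$, and let $\xi_{n,k}$ ($n\ge 0$, $k\ge 1$) be independent random $p\times p$ matrices with entries in $\mathbb N=\{0,1,2,\dots\}$ such that the $i$-th row $\xi_{n,k}(i,\cdot)$ has law $g_n^{(i)}$ for all $n,k,i$. The $p$-type Galton–Watson process in the varying environment $\mathbf g$ is defined by $Z_0(i,j)=\delta_{ij}$ and $$Z_{n+1}(i,j)=\sum_{\ell=1}^p\ \sum_{k=1+Z_n(i,1)+\dots+Z_n(i,\ell-1)}^{Z_n(i,1)+\dots+Z_n(i,\ell)}\xi_{n,k}(\ell,j),$$ so that $Z_n(i,j)$ is the number of particles of type $j$ in generation $n$ descending from one ancestor of type $i$. Let $M_{g_n}(i,j)$ and $\sigma^2_{g_n}(i,j)$ be the mean and the variance of the number of children of type $j$ of a parent of type $i$ under $g_n$, and let $M_{0,n}=M_{g_0}M_{g_1}\cdots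 M_{g_{n-1}}$, $M_{0,0}=I$. Assume: (a) there is $B>1$ such that for every $n\ge0$ the matrix $M_{g_n}$ lies in $S^+(B)$, i.e. it has positive entries and $\frac1B\le \frac{M_{g_n}(i,j)}{M_{g_n}(k,l)}\le B$ for all $i,j,k,l$; (b) there are $\varepsilon\in(0,1)$ and $K>0$ such that for every $n\ge0$ one has $g_n\in\mathcal G_{\varepsilon,K}$, i.e. for all $i,j$, and with $\xi(i,\cdot)$ of law $g_n^{(i)}$: $\mathbb P(\xi(i,j)\ge2)\ge\varepsilon$, $\mathbb P(\xi(i,\cdot)=\mathbf 0)\ge\varepsilon$ and $\mathbb E\big[|\xi(i,\cdot)|^2\big]\le K$; (c) for some $i,j$, $\displaystyle\sum_{n\ge0}\frac1{|M_{0,n}|}\,\frac{\sigma^2_{g_n}(i,j)}{|M_{g_{n+1}}|^2}<+\infty$; (d) for some $i,j$, $\displaystyle\sum_{n\ge1}\frac1{M_{0,n}(i,j)}<+\infty$. Then there are non-negative square-integrable random variables $\mathcal W(i)$, $1\le i\le p$, such that for all $i,j$ $$\frac{Z_n(i,j)}{|M_{0,n}(\cdot,j)|}\ \longrightarrow\ \mathcal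 W(i)\quad\text{in } L^2(\mathbb P)\text{ as } n\to\infty,$$ and for this (almost surely unique) limit and every $1\le i\le p$, $$\mathbb P\big(\mathcal W(i)=0\big)=\mathbb P\Big(\liminf_{n\to\infty}|Z_n(i,\cdot)|=0\Big)=q_i,$$ where $q_i=\mathbb P(\exists\, n\ge 0:\ Z_n(i,\cdot)=\mathbf 0)$ is the extinction probability of the process started from one ancestor of type $i$. -/

import Mathlib

open MeasureTheory ProbabilityTheory Filter
open scoped Topology ENNReal

namespace MGW

noncomputable section

/-- An offspring law for `p` types: `g i` is the probability distribution on `ℕ^p` of the vector of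
children of a parent of type `i`, that is, the family of coefficients of the multivariate
probability generating function `g⁽ⁱ⁾`. -/
abbrev OffspringLaw (p : ℕ) : Type := Fin p → PMF (Fin p → ℕ)

/-- The mean matrix: `M_g (i, j)` is the expected number of children of type `j` of a parent of
type `i`. -/
def meanMatrix {p : ℕ} (g : OffspringLaw p) : Matrix (Fin p) (Fin p) ℝ :=
  Matrix.of fun i j => ∫ α, (α j : ℝ) ∂(g i).toMeasure

/-- `σ²_g (i, j)`, the variance of the number of children of type `j` of a parent of type `i`. -/
def offspringVar {p : ℕ} (g : OffspringLaw p) (i j : Fin p) : ℝ :=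
  variance (fun α : Fin p → ℕ => (α j : ℝ)) (g i).toMeasure

/-- The product `M_{0,n} = M_{g_0} ⋯ M_{g_{n-1}}`, with `M_{0,0} = I`. -/
def meanProd {p : ℕ} (g : ℕ → OffspringLaw p) : ℕ → Matrix (Fin p) (Fin p) ℝ
  | 0 => 1
  | n + 1 => meanProd g n * meanMatrix (g n)

/-- The `L¹` norm of a matrix, the sum of the absolute values of all its entries. -/
def matNorm {p : ℕ} (M : Matrix (Fin p) (Fin p) ℝ) : ℝ := ∑ i, ∑ j, |M i j|

/-- The `L¹` norm `|M(·, j)|` of the `j`-th column. -/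
def colNorm {p : ℕ} (M : Matrix (Fin p) (Fin p) ℝ) (j : Fin p) : ℝ := ∑ i, |M i j|

/-- `S⁺(B)`: matrices with positive entries whose pairwise ratios lie in `[1/B, B]`. -/
def SPlus (p : ℕ) (B : ℝ) : Set (Matrix (Fin p) (Fin p) ℝ) :=
  {M | (∀ i j, 0 < M i j) ∧ ∀ i j k l, 1 / B ≤ M i j / M k l ∧ M i j / M k l ≤ B}

/-- The class `G_{ε,K}`: for all types `i, j`, a parent of type `i` has at least two children of
type `j` with probability at least `ε`, has no child at all with probability at least `ε`, and the
second moment of its total number of children is at most `K`. -/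
def GClass (p : ℕ) (ε K : ℝ) : Set (OffspringLaw p) :=
  {g | (∀ i j, ENNReal.ofReal ε ≤ (g i).toMeasure {α | 2 ≤ α j}) ∧
    (∀ i, ENNReal.ofReal ε ≤ (g i).toMeasure {α | ∀ j, α j = 0}) ∧
    ∀ i, ∫⁻ α, ((∑ j, α j : ℕ) : ℝ≥0∞) ^ 2 ∂(g i).toMeasure ≤ ENNReal.ofReal K}

/-- The random variables driving the process in the environment `g`: the matrices `ξ_{n,k}`
are independent over all `n, k`, and for every `n, k, i` the `i`-th row of `ξ_{n,k}` has law
`g_n⁽ⁱ⁾`. (Nothing is required of the joint law of the rows of one matrix.) -/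
structure IsOffspringFamily {p : ℕ} {Ω : Type*} [MeasurableSpace Ω] (μ : Measure Ω)
    (g : ℕ → OffspringLaw p) (ξ : ℕ → ℕ → Ω → Fin p → Fin p → ℕ) : Prop where
  measurable : ∀ n k, Measurable (ξ n k)
  indep : iIndepFun (fun nk : ℕ × ℕ => ξ nk.1 nk.2) μ
  law : ∀ n k i, μ.map (fun ω => ξ n k ω i) = (g n i).toMeasure

/-- The Galton–Watson process: `gwProcess ξ n ω i j` is the number `Z_n(i, j)` of particles of
type `j` in generation `n` when there is one ancestor, of type `i`. In generation `n` the particles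
are numbered `k = 0, 1, 2, …`, those of type `0` first, then those of type `1`, and so on; the
particle with number `k`, of type `l`, has the children `ξ_{n,k}(l, ·)`. -/
def gwProcess {p : ℕ} {Ω : Type*} (ξ : ℕ → ℕ → Ω → Fin p → Fin p → ℕ) :
    ℕ → Ω → Fin p → Fin p → ℕ
  | 0 => fun _ i j => if i = j then 1 else 0
  | n + 1 => fun ω i j =>
      ∑ l, ∑ k ∈ Finset.Ico (∑ m ∈ Finset.Iio l, gwProcess ξ n ω i m)
        (∑ m ∈ Finset.Iic l, gwProcess ξ n ω i m), ξ n k ω l j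

/-- The size `|Z_n(i, ·)|` of generation `n` when there is one ancestor, of type `i`. -/
def popSize {p : ℕ} {Ω : Type*} (ξ : ℕ → ℕ → Ω → Fin p → Fin p → ℕ) (n : ℕ) (ω : Ω)
    (i : Fin p) : ℕ := ∑ j, gwProcess ξ n ω i j

/-- The extinction probability `q_i` of the process started from one ancestor of type `i`. -/
def extinctionProb {p : ℕ} {Ω : Type*} [MeasurableSpace Ω] (μ : Measure Ω)
    (ξ : ℕ → ℕ → Ω → Fin p → Fin p → ℕ) (i : Fin p) : ℝ≥0∞ :=
  μ {ω | ∃ n, popSize ξ n ω i = 0}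

/-- The normalized process `W_n(i, j) = Z_n(i, j) / |M_{0,n}(·, j)|`. -/
def normalized {p : ℕ} {Ω : Type*} (g : ℕ → OffspringLaw p)
    (ξ : ℕ → ℕ → Ω → Fin p → Fin p → ℕ) (n : ℕ) (i j : Fin p) (ω : Ω) : ℝ :=
  (gwProcess ξ n ω i j : ℝ) / colNorm (meanProd g n) j

/-- `W` is the `L²` limit of the normalized process: `W(i) ∈ L²` and `W_n(i, j) → W(i)` in `L²`
for all `i` and `j`, the limit being the same for all `j`. -/
def IsL2Limit {p : ℕ} {Ω : Type*} [MeasurableSpace Ω] (μ : Measure Ω) (g : ℕ → OffspringLaw p)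
    (ξ : ℕ → ℕ → Ω → Fin p → Fin p → ℕ) (W : Fin p → Ω → ℝ) : Prop :=
  (∀ i, MemLp (W i) 2 μ) ∧
    ∀ i j, Tendsto (fun n => eLpNorm (fun ω => normalized g ξ n i j ω - W i ω) 2 μ) atTop (𝓝 0)

end

end MGW

/-! Let `v_n(j)` be the column sums `colNorm (meanProd g n) j` and `m_n = |M_{0,n}|`. By (a) and
(b), all `v_n(j)` are comparable with `m_n`, and (d) gives `∑ 1 / m_n < ∞`.

L² convergence. For fixed `k`, the ratios `M_{k,k+d}(i,j) / v_{k+d}(j)` evolve in `d` by averaging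
over types with weights bounded below, so they merge to a limit `h_k(i)` that does not depend on `j`
(`exists_tendsto_meanProdFrom`). Telescoping conditional variances (`lintegral_sq_increment_le`)
shows that `W_{k+d}(i,j)` stays near `∑ r, Z_k(i,r) h_k(r)`, with squared error at most a constant
times `∑_{l>k} 1 / m_l`, up to a term vanishing as `d → ∞`. Completeness of L² gives one limit for
all `j` (`exists_common_limit`).

Zero set of the limit. Extinction clearly forces `W(i) = 0`. For the converse, mark the particles of
generation `N` independently and follow the probabilities `s_n(r)` that a particle of generation `n`
has a marked descendant. The conditions on the offspring give `(M s)_r / (1 + C|s|) ≤ markProb ≤ (M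
s)_r (1 - c|s|)`, hence `y_n = ∑ v_n(r) s_n(r)` satisfies `1/y_n = 1/y_N` plus a quantity of order
`∑_{n<l≤N} 1 / m_l`. Marking everybody (survival) and marking type `j` with probability `1 - exp(-λ
/ v_N(j))`, `λ = m_{n+1}`, therefore have comparable probabilities, uniformly in `n < N`
(`exists_pow_markIter_le`). The second marking encodes the Laplace transform of `W_N(i,j)` at `λ`,
so this transform is controlled by the probability of being alive at time `n` yet extinct at time
`N`, which is small for large `n`. Fatou's lemma as `N → ∞`, then `n → ∞`, gives `P(W(i) = 0) ≤ q_i`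
(`measure_limit_eq_zero_le`). -/

namespace MGW

/-- The probability that at least one child of a parent with offspring law `ν` is marked, when a
child of type `j` is marked with probability `s j`, independently of everything else. -/
noncomputable def markProb {p : ℕ} (ν : Measure (Fin p → ℕ)) (s : Fin p → ℝ) : ℝ :=
  ∫ α, (1 - ∏ j, (1 - s j) ^ α j) ∂ν

/-! ### One generation: two-sided bounds on the marking probability. -/

section OneLaw

variable {p : ℕ} {ν : Measure (Fin p → ℕ)} {s : Fin p → ℝ} {ε K : ℝ}

lemma prod_one_sub_pow_mem (hs : ∀ j, s j ∈ Set.Icc (0 : ℝ) 1) (α : Fin p → ℕ) :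
    ∏ j, (1 - s j) ^ α j ∈ Set.Icc (0 : ℝ) 1 := by
  have h0 : ∀ j, 0 ≤ 1 - s j := fun j => by linarith [(hs j).2]
  exact ⟨Finset.prod_nonneg fun j _ => pow_nonneg (h0 j) _,
    Finset.prod_le_one (fun j _ => pow_nonneg (h0 j) _)
      fun j _ => pow_le_one₀ (h0 j) (by linarith [(hs j).1])⟩

lemma integrable_markProb [IsProbabilityMeasure ν] (hs : ∀ j, s j ∈ Set.Icc (0 : ℝ) 1) :
    Integrable (fun α => ∏ j, (1 - s j) ^ α j) ν := by
  refine Integrable.of_bound (C := 1) Measurable.of_discrete.aestronglyMeasurable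
    (ae_of_all _ fun α => ?_)
  have := prod_one_sub_pow_mem hs α
  rw [Real.norm_eq_abs, abs_of_nonneg this.1]
  exact this.2

lemma integral_prod_one_sub_pow [IsProbabilityMeasure ν] (hs : ∀ j, s j ∈ Set.Icc (0 : ℝ) 1) :
    ∫ α, ∏ j, (1 - s j) ^ α j ∂ν = 1 - markProb ν s := by
  rw [markProb, integral_sub (integrable_const _) (integrable_markProb hs)]
  simp

lemma markProb_mem [IsProbabilityMeasure ν] (hs : ∀ j, s j ∈ Set.Icc (0 : ℝ) 1) :
    markProb ν s ∈ Set.Icc (0 : ℝ) 1 := by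
  constructor
  · exact integral_nonneg fun α => by
      have := (prod_one_sub_pow_mem hs α).2
      simp only [Pi.zero_apply]; linarith
  · have : 0 ≤ ∫ α, ∏ j, (1 - s j) ^ α j ∂ν :=
      integral_nonneg fun α => (prod_one_sub_pow_mem hs α).1
    rw [integral_prod_one_sub_pow hs] at this
    linarith

lemma markProb_le_one_sub [IsProbabilityMeasure ν] (hs : ∀ j, s j ∈ Set.Icc (0 : ℝ) 1)
    (hε : 0 ≤ ε) (h0 : ENNReal.ofReal ε ≤ ν {α | ∀ j, α j = 0}) : markProb ν s ≤ 1 - ε := by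
  have h1 : ε ≤ ν.real {α | ∀ j, α j = 0} := by
    rw [Measure.real, ← ENNReal.toReal_ofReal hε]
    exact ENNReal.toReal_mono (measure_ne_top _ _) h0
  have h2 : ν.real {α : Fin p → ℕ | ∀ j, α j = 0} ≤ ∫ α, ∏ j, (1 - s j) ^ α j ∂ν := by
    rw [← integral_indicator_one MeasurableSet.of_discrete]
    refine integral_mono ((integrable_const (1 : ℝ)).indicator MeasurableSet.of_discrete)
      (integrable_markProb hs) fun α => ?_
    by_cases h : α ∈ {α : Fin p → ℕ | ∀ j, α j = 0}
    · have h' : ∀ j, α j = 0 := h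
      simp [h']
    · rw [Set.indicator_of_notMem h]
      exact (prod_one_sub_pow_mem hs α).1
  rw [integral_prod_one_sub_pow hs] at h2
  linarith

/-- The second moment of the total number of children. -/
lemma integrable_sum_sq
    (hK : ∫⁻ α, ((∑ j, α j : ℕ) : ℝ≥0∞) ^ 2 ∂ν ≤ ENNReal.ofReal K) :
    Integrable (fun α : Fin p → ℕ => (∑ j, (α j : ℝ)) ^ 2) ν := by
  refine ⟨Measurable.of_discrete.aestronglyMeasurable, ?_⟩
  refine lt_of_le_of_lt (le_of_eq ?_) (hK.trans_lt ENNReal.ofReal_lt_top)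
  refine lintegral_congr fun α => ?_
  change ‖(∑ j, (α j : ℝ)) ^ 2‖ₑ = _
  rw [Real.enorm_of_nonneg (sq_nonneg _), ← Nat.cast_sum, ← Nat.cast_pow, ← Nat.cast_pow,
    ENNReal.ofReal_natCast]

lemma integral_sum_sq_le (hK0 : 0 ≤ K)
    (hK : ∫⁻ α, ((∑ j, α j : ℕ) : ℝ≥0∞) ^ 2 ∂ν ≤ ENNReal.ofReal K) :
    ∫ α, (∑ j, (α j : ℝ)) ^ 2 ∂ν ≤ K := by
  rw [integral_eq_lintegral_of_nonneg_ae (ae_of_all _ fun _ => sq_nonneg _)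
    Measurable.of_discrete.aestronglyMeasurable]
  refine ENNReal.toReal_le_of_le_ofReal hK0 (le_trans (le_of_eq ?_) hK)
  refine lintegral_congr fun α => ?_
  rw [← Nat.cast_sum, ← Nat.cast_pow, ← Nat.cast_pow, ENNReal.ofReal_natCast]

lemma sum_le_sum_sq (α : Fin p → ℕ) : ∑ j, (α j : ℝ) ≤ (∑ j, (α j : ℝ)) ^ 2 := by
  rw [← Nat.cast_sum]
  exact_mod_cast Nat.le_self_pow two_ne_zero _

lemma integrable_coord
    (hK : ∫⁻ α, ((∑ j, α j : ℕ) : ℝ≥0∞) ^ 2 ∂ν ≤ ENNReal.ofReal K) (j : Fin p) :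
    Integrable (fun α : Fin p → ℕ => (α j : ℝ)) ν := by
  refine (integrable_sum_sq hK).mono' Measurable.of_discrete.aestronglyMeasurable
    (ae_of_all _ fun α => ?_)
  rw [Real.norm_natCast]
  exact (Finset.single_le_sum (f := fun j => (α j : ℝ)) (fun _ _ => Nat.cast_nonneg _)
    (Finset.mem_univ j)).trans (sum_le_sum_sq α)

lemma integral_dot
    (hK : ∫⁻ α, ((∑ j, α j : ℕ) : ℝ≥0∞) ^ 2 ∂ν ≤ ENNReal.ofReal K) (a : Fin p → ℝ) :
    ∫ α, ∑ j, (α j : ℝ) * a j ∂ν = ∑ j, (∫ α, (α j : ℝ) ∂ν) * a j := by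
  rw [integral_finsetSum _ fun j _ => (integrable_coord hK j).mul_const _]
  simp_rw [integral_mul_const]

lemma integrable_dot
    (hK : ∫⁻ α, ((∑ j, α j : ℕ) : ℝ≥0∞) ^ 2 ∂ν ≤ ENNReal.ofReal K) (a : Fin p → ℝ) :
    Integrable (fun α : Fin p → ℕ => ∑ j, (α j : ℝ) * a j) ν :=
  integrable_finsetSum _ fun j _ => (integrable_coord hK j).mul_const _

lemma dot_sq_le {a : Fin p → ℝ} {A : ℝ} (ha : ∀ j, |a j| ≤ A) (α : Fin p → ℕ) :
    (∑ j, (α j : ℝ) * a j) ^ 2 ≤ A ^ 2 * (∑ j, (α j : ℝ)) ^ 2 := by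
  rw [← mul_pow, ← sq_abs]
  refine pow_le_pow_left₀ (abs_nonneg _) ?_ 2
  refine (Finset.abs_sum_le_sum_abs _ _).trans ?_
  rw [Finset.mul_sum]
  refine Finset.sum_le_sum fun j _ => ?_
  rw [abs_mul, Nat.abs_cast, mul_comm]
  exact mul_le_mul_of_nonneg_right (ha j) (Nat.cast_nonneg _)

lemma integrable_dot_sq
    (hK : ∫⁻ α, ((∑ j, α j : ℕ) : ℝ≥0∞) ^ 2 ∂ν ≤ ENNReal.ofReal K) (a : Fin p → ℝ) :
    Integrable (fun α : Fin p → ℕ => (∑ j, (α j : ℝ) * a j) ^ 2) ν := by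
  refine ((integrable_sum_sq hK).const_mul ((∑ j, |a j|) ^ 2)).mono'
    Measurable.of_discrete.aestronglyMeasurable (ae_of_all _ fun α => ?_)
  rw [Real.norm_of_nonneg (sq_nonneg _)]
  exact dot_sq_le (fun j => Finset.single_le_sum (f := fun j => |a j|)
    (fun _ _ => abs_nonneg _) (Finset.mem_univ j)) α

lemma integral_dot_sq_le (hK0 : 0 ≤ K)
    (hK : ∫⁻ α, ((∑ j, α j : ℕ) : ℝ≥0∞) ^ 2 ∂ν ≤ ENNReal.ofReal K) {a : Fin p → ℝ} {A : ℝ}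
    (ha : ∀ j, |a j| ≤ A) : ∫ α, (∑ j, (α j : ℝ) * a j) ^ 2 ∂ν ≤ A ^ 2 * K := by
  refine (integral_mono (integrable_dot_sq hK a) ((integrable_sum_sq hK).const_mul (A ^ 2))
    (dot_sq_le ha)).trans ?_
  rw [integral_const_mul]
  exact mul_le_mul_of_nonneg_left (integral_sum_sq_le hK0 hK) (sq_nonneg _)

lemma sum_integral_coord_le (hK0 : 0 ≤ K)
    (hK : ∫⁻ α, ((∑ j, α j : ℕ) : ℝ≥0∞) ^ 2 ∂ν ≤ ENNReal.ofReal K) :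
    ∑ j, ∫ α, (α j : ℝ) ∂ν ≤ K := by
  rw [← integral_finsetSum _ fun j _ => integrable_coord hK j]
  exact (integral_mono (integrable_finsetSum _ fun j _ => integrable_coord hK j)
    (integrable_sum_sq hK) sum_le_sum_sq).trans (integral_sum_sq_le hK0 hK)

lemma two_mul_le_integral_coord [IsProbabilityMeasure ν] (hε : 0 ≤ ε)
    (hK : ∫⁻ α, ((∑ j, α j : ℕ) : ℝ≥0∞) ^ 2 ∂ν ≤ ENNReal.ofReal K) {j : Fin p}
    (h2 : ENNReal.ofReal ε ≤ ν {α | 2 ≤ α j}) : 2 * ε ≤ ∫ α, (α j : ℝ) ∂ν := by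
  have h1 : ε ≤ ν.real {α | 2 ≤ α j} := by
    rw [Measure.real, ← ENNReal.toReal_ofReal hε]
    exact ENNReal.toReal_mono (measure_ne_top _ _) h2
  have h3 := mul_meas_ge_le_integral_of_nonneg (μ := ν) (f := fun α : Fin p → ℕ => (α j : ℝ))
    (ae_of_all _ fun _ => Nat.cast_nonneg _) (integrable_coord hK j) 2
  have h4 : {α : Fin p → ℕ | (2 : ℝ) ≤ (α j : ℝ)} = {α | 2 ≤ α j} := by
    ext α; simp
  rw [h4] at h3
  linarith

/-- Bernoulli's inequality with a quadratic gain, which is an equality at `a = 2`. The gain makes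
the survival probability decay below its linear bound. -/
lemma one_sub_mul_add_sq_le_pow {t : ℝ} (h1 : t ≤ 1) (a : ℕ) :
    1 - a * t + (if 2 ≤ a then t ^ 2 else 0) ≤ (1 - t) ^ a := by
  rcases a with _ | _ | a
  · simp
  · simp
  · rw [if_pos (by omega)]
    induction a with
    | zero => norm_num; nlinarith
    | succ a ih =>
      rw [pow_succ]
      have := mul_le_mul_of_nonneg_right ih (sub_nonneg.2 h1)
      refine le_trans ?_ this
      push_cast
      have ha : (0 : ℝ) ≤ a := Nat.cast_nonneg a
      nlinarith [mul_nonneg ha (sq_nonneg t), mul_le_mul_of_nonneg_right h1 (sq_nonneg t)]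

lemma one_sub_sum_le_prod {ι : Type*} (S : Finset ι) (x : ι → ℝ) (h0 : ∀ i ∈ S, 0 ≤ x i)
    (h1 : ∀ i ∈ S, x i ≤ 1) : 1 - ∑ i ∈ S, (1 - x i) ≤ ∏ i ∈ S, x i := by
  classical
  induction S using Finset.induction_on with
  | empty => simp
  | insert a S ha ih =>
    rw [Finset.sum_insert ha, Finset.prod_insert ha]
    have ih := ih (fun i hi => h0 i (Finset.mem_insert_of_mem hi))
      (fun i hi => h1 i (Finset.mem_insert_of_mem hi))
    have hS1 : ∏ i ∈ S, x i ≤ 1 :=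
      Finset.prod_le_one (fun i hi => h0 i (Finset.mem_insert_of_mem hi))
        (fun i hi => h1 i (Finset.mem_insert_of_mem hi))
    have := h0 a (Finset.mem_insert_self _ _)
    have := h1 a (Finset.mem_insert_self _ _)
    nlinarith

lemma one_sub_prod_le (hs : ∀ j, s j ∈ Set.Icc (0 : ℝ) 1) (α : Fin p → ℕ) (j₀ : Fin p) :
    1 - ∏ j, (1 - s j) ^ α j ≤
      ∑ j, (α j : ℝ) * s j - s j₀ ^ 2 * Set.indicator {α : Fin p → ℕ | 2 ≤ α j₀} 1 α := by
  have h0 : ∀ j, 0 ≤ 1 - s j := fun j => by linarith [(hs j).2]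
  have h1 := one_sub_sum_le_prod Finset.univ (fun j => (1 - s j) ^ α j)
    (fun j _ => pow_nonneg (h0 j) _) (fun j _ => pow_le_one₀ (h0 j) (by linarith [(hs j).1]))
  have h2 : ∑ j, (1 - (1 - s j) ^ α j) ≤
      ∑ j, ((α j : ℝ) * s j - if j = j₀ then s j₀ ^ 2 * Set.indicator {α : Fin p → ℕ | 2 ≤ α j₀} 1 α
        else 0) := by
    refine Finset.sum_le_sum fun j _ => ?_
    have h3 := one_sub_mul_add_sq_le_pow (hs j).2 (α j)
    by_cases hj : j = j₀
    · subst hj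
      rw [if_pos rfl, Set.indicator_apply]
      simp only [Set.mem_ofPred_eq, Pi.one_apply, mul_ite, mul_one, mul_zero]
      linarith
    · rw [if_neg hj]
      have : (0 : ℝ) ≤ if 2 ≤ α j then s j ^ 2 else 0 := by positivity
      linarith
  rw [Finset.sum_sub_distrib (fun j => (α j : ℝ) * s j), Finset.sum_ite_eq' Finset.univ j₀] at h2
  simp only [Finset.mem_univ, if_true] at h2
  linarith

lemma markProb_le_sub_sq [IsProbabilityMeasure ν] (hε : 0 ≤ ε)
    (hK : ∫⁻ α, ((∑ j, α j : ℕ) : ℝ≥0∞) ^ 2 ∂ν ≤ ENNReal.ofReal K)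
    (hs : ∀ j, s j ∈ Set.Icc (0 : ℝ) 1) {j₀ : Fin p}
    (h2 : ENNReal.ofReal ε ≤ ν {α | 2 ≤ α j₀}) :
    markProb ν s ≤ ∑ j, (∫ α, (α j : ℝ) ∂ν) * s j - ε * s j₀ ^ 2 := by
  have h1 : ε ≤ ν.real {α | 2 ≤ α j₀} := by
    rw [Measure.real, ← ENNReal.toReal_ofReal hε]
    exact ENNReal.toReal_mono (measure_ne_top _ _) h2
  have hi : Integrable (fun α => Set.indicator {α : Fin p → ℕ | 2 ≤ α j₀} (1 : (Fin p → ℕ) → ℝ) α) ν :=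
    (integrable_const (1 : ℝ)).indicator MeasurableSet.of_discrete
  have h3 := integral_mono ((integrable_const (1 : ℝ)).sub (integrable_markProb (ν := ν) hs))
    ((integrable_dot hK s).sub (hi.const_mul (s j₀ ^ 2))) (fun α => one_sub_prod_le hs α j₀)
  simp only [Pi.sub_apply] at h3
  rw [integral_sub (integrable_dot hK s) (hi.const_mul (s j₀ ^ 2)), integral_dot hK,
    integral_const_mul, integral_indicator_one MeasurableSet.of_discrete] at h3
  have := mul_le_mul_of_nonneg_left h1 (sq_nonneg (s j₀))
  rw [markProb]
  linarith

/-- The right side is at least `1 - exp (-x) ≥ x / (1 + x)`, and `1 / (1 + x) ≥ 2t - t² (1 + x)` by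
completing a square. The free parameter `t` yields a bound that integrates using only the first two
moments. -/
lemma le_one_sub_prod (hs : ∀ j, s j ∈ Set.Icc (0 : ℝ) 1) (α : Fin p → ℕ) (t : ℝ) :
    2 * t * (∑ j, (α j : ℝ) * s j) - t ^ 2 * (∑ j, (α j : ℝ) * s j + (∑ j, (α j : ℝ) * s j) ^ 2) ≤
      1 - ∏ j, (1 - s j) ^ α j := by
  set x := ∑ j, (α j : ℝ) * s j with hx
  have hx0 : 0 ≤ x := Finset.sum_nonneg fun j _ => mul_nonneg (Nat.cast_nonneg _) (hs j).1
  have h1 : ∏ j, (1 - s j) ^ α j ≤ Real.exp (-x) := by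
    rw [hx, ← Finset.sum_neg_distrib, Real.exp_sum]
    refine Finset.prod_le_prod (fun j _ => pow_nonneg (by linarith [(hs j).2]) _) fun j _ => ?_
    rw [← mul_neg, Real.exp_nat_mul]
    exact pow_le_pow_left₀ (by linarith [(hs j).2]) (Real.one_sub_le_exp_neg _) _
  have h2 : Real.exp (-x) ≤ 1 / (1 + x) := by
    rw [Real.exp_neg, ← one_div]
    exact one_div_le_one_div_of_le (by linarith) (by linarith [Real.add_one_le_exp x])
  have h3 : 2 * t * x - t ^ 2 * (x + x ^ 2) ≤ 1 - 1 / (1 + x) := by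
    have : 1 - 1 / (1 + x) - (2 * t * x - t ^ 2 * (x + x ^ 2)) =
        x * (1 - t * (1 + x)) ^ 2 / (1 + x) := by
      field_simp
      ring
    have h4 : 0 ≤ x * (1 - t * (1 + x)) ^ 2 / (1 + x) := by positivity
    linarith
  linarith

lemma div_le_markProb [IsProbabilityMeasure ν] (hε : 0 < ε) (hK0 : 0 ≤ K)
    (hK : ∫⁻ α, ((∑ j, α j : ℕ) : ℝ≥0∞) ^ 2 ∂ν ≤ ENNReal.ofReal K)
    (hs : ∀ j, s j ∈ Set.Icc (0 : ℝ) 1)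
    (h2 : ∀ j, ENNReal.ofReal ε ≤ ν {α | 2 ≤ α j}) :
    (∑ j, (∫ α, (α j : ℝ) ∂ν) * s j) / (1 + K / (2 * ε) * ∑ j, s j) ≤ markProb ν s := by
  set m := ∑ j, (∫ α, (α j : ℝ) ∂ν) * s j with hm
  set S := ∑ j, s j with hS
  have hS0 : 0 ≤ S := Finset.sum_nonneg fun j _ => (hs j).1
  have hmS : 2 * ε * S ≤ m := by
    rw [hS, Finset.mul_sum]
    exact Finset.sum_le_sum fun j _ => mul_le_mul_of_nonneg_right
      (two_mul_le_integral_coord hε.le hK (h2 j)) (hs j).1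
  have hsq : ∫ α, (∑ j, (α j : ℝ) * s j) ^ 2 ∂ν ≤ S ^ 2 * K :=
    integral_dot_sq_le hK0 hK fun j => by
      rw [abs_of_nonneg (hs j).1]
      exact Finset.single_le_sum (f := s) (fun j _ => (hs j).1) (Finset.mem_univ j)
  -- This `t` is chosen for `E[x + x²] ≤ m / t`, which follows from `E[x²] ≤ K S²` and `S ≤ m /
  -- (2ε)`; the bound `2tm - t² E[x + x²]` is then at least `tm`.
  set t := 1 / (1 + K / (2 * ε) * S) with ht
  have hpos : 0 < 1 + K / (2 * ε) * S := by positivity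
  have h3 := integral_mono
    (((integrable_dot hK s).const_mul (2 * t)).sub
      (((integrable_dot hK s).add (integrable_dot_sq hK s)).const_mul (t ^ 2)))
    ((integrable_const (1 : ℝ)).sub (integrable_markProb (ν := ν) hs))
    (fun α => le_one_sub_prod hs α t)
  simp only [Pi.sub_apply, Pi.add_apply] at h3
  have h3' : Integrable (fun α : Fin p → ℕ =>
      t ^ 2 * (∑ j, (α j : ℝ) * s j + (∑ j, (α j : ℝ) * s j) ^ 2)) ν :=
    ((integrable_dot hK s).add (integrable_dot_sq hK s)).const_mul (t ^ 2)
  rw [integral_sub ((integrable_dot hK s).const_mul (2 * t)) h3',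
    integral_const_mul, integral_const_mul,
    integral_add (integrable_dot hK s) (integrable_dot_sq hK s), integral_dot hK] at h3
  rw [markProb]
  refine le_trans ?_ h3
  have h4 : S ^ 2 * K ≤ m * (K / (2 * ε) * S) := by
    have := mul_le_mul_of_nonneg_right hmS (show 0 ≤ K / (2 * ε) * S by positivity)
    refine le_trans (le_of_eq ?_) this
    field_simp
  have h5 : t ^ 2 * (m + ∫ α, (∑ j, (α j : ℝ) * s j) ^ 2 ∂ν) ≤ t ^ 2 * (m * (1 + K / (2 * ε) * S)) :=
    mul_le_mul_of_nonneg_left (by linarith) (sq_nonneg _)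
  have h6 : t ^ 2 * (m * (1 + K / (2 * ε) * S)) = t * m := by
    rw [ht]; field_simp
  have h7 : m / (1 + K / (2 * ε) * S) = t * m := by rw [ht]; ring
  rw [h7]
  linarith

/-- Apply the quadratic gain to the type `j₀` with the largest `s`: both `∑ s ≤ p * s j₀` and the
mean term `≤ K * s j₀`, so the gain `ε * s j₀ ^ 2` dominates a multiple of their product. -/
lemma markProb_le_mul [IsProbabilityMeasure ν] (hp : 0 < p) (hε : 0 < ε) (hK0 : 0 < K)
    (hK : ∫⁻ α, ((∑ j, α j : ℕ) : ℝ≥0∞) ^ 2 ∂ν ≤ ENNReal.ofReal K)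
    (hs : ∀ j, s j ∈ Set.Icc (0 : ℝ) 1)
    (h2 : ∀ j, ENNReal.ofReal ε ≤ ν {α | 2 ≤ α j}) :
    markProb ν s ≤ (∑ j, (∫ α, (α j : ℝ) ∂ν) * s j) * (1 - ε / (K * p) * ∑ j, s j) := by
  have : Nonempty (Fin p) := ⟨⟨0, hp⟩⟩
  obtain ⟨j₀, hj₀⟩ := Finite.exists_max s
  refine (markProb_le_sub_sq hε.le hK hs (h2 j₀)).trans ?_
  have hmean : ∀ j, 0 ≤ ∫ α, (α j : ℝ) ∂ν := fun j => integral_nonneg fun _ => Nat.cast_nonneg _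
  have h3 : ∑ j, (∫ α, (α j : ℝ) ∂ν) * s j ≤ K * s j₀ := by
    refine (Finset.sum_le_sum fun j _ => mul_le_mul_of_nonneg_left (hj₀ j) (hmean j)).trans ?_
    rw [← Finset.sum_mul]
    exact mul_le_mul_of_nonneg_right (sum_integral_coord_le hK0.le hK) (hs j₀).1
  have h4 : ∑ j, s j ≤ p * s j₀ := by
    refine (Finset.sum_le_sum fun j _ => hj₀ j).trans ?_
    simp
  have hp' : (0 : ℝ) < p := by exact_mod_cast hp
  have h5 : (∑ j, (∫ α, (α j : ℝ) ∂ν) * s j) * (∑ j, s j) ≤ (K * s j₀) * (p * s j₀) :=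
    mul_le_mul h3 h4 (Finset.sum_nonneg fun j _ => (hs j).1)
      (mul_nonneg hK0.le (hs j₀).1)
  have h6 := mul_le_mul_of_nonneg_left h5 (show 0 ≤ ε / (K * p) by positivity)
  have h7 : ε / (K * p) * ((K * s j₀) * (p * s j₀)) = ε * s j₀ ^ 2 := by field_simp
  nlinarith

end OneLaw

/-! ### Several generations: marking probabilities along the environment. -/

/-- `markIter g n d s i` is the probability that, of the descendants in generation `n + d` of a
particle of type `i` living in generation `n`, at least one is marked, when a particle of type `j` is
marked with probability `s j`. -/
noncomputable def markIter {p : ℕ} (g : ℕ → OffspringLaw p) :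
    ℕ → ℕ → (Fin p → ℝ) → Fin p → ℝ
  | _, 0, s => s
  | n, d + 1, s => fun i => markProb (g n i).toMeasure (markIter g (n + 1) d s)

section Environment

variable {p : ℕ} {g : ℕ → OffspringLaw p} {B ε K : ℝ}

lemma markIter_mem {s : Fin p → ℝ} (hs : ∀ j, s j ∈ Set.Icc (0 : ℝ) 1) (n d : ℕ) :
    ∀ i, markIter g n d s i ∈ Set.Icc (0 : ℝ) 1 := by
  induction d generalizing n with
  | zero => exact hs
  | succ d ih => exact fun i => markProb_mem (ih (n + 1))

lemma two_mul_le_meanMatrix (hε : 0 < ε) (hG : ∀ n, g n ∈ GClass p ε K) (n : ℕ) (i j : Fin p) :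
    2 * ε ≤ meanMatrix (g n) i j :=
  two_mul_le_integral_coord hε.le ((hG n).2.2 i) ((hG n).1 i j)

lemma meanProd_nonneg (hM : ∀ n, meanMatrix (g n) ∈ SPlus p B) (n : ℕ) (i j : Fin p) :
    0 ≤ meanProd g n i j := by
  induction n generalizing j with
  | zero =>
    rw [meanProd, Matrix.one_apply]
    positivity
  | succ n ih =>
    rw [meanProd, Matrix.mul_apply]
    exact Finset.sum_nonneg fun r _ => mul_nonneg (ih r) ((hM n).1 r j).le

lemma colNorm_meanProd (hM : ∀ n, meanMatrix (g n) ∈ SPlus p B) (n : ℕ) (j : Fin p) :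
    colNorm (meanProd g n) j = ∑ i, meanProd g n i j :=
  Finset.sum_congr rfl fun i _ => abs_of_nonneg (meanProd_nonneg hM n i j)

lemma matNorm_eq_sum_colNorm (M : Matrix (Fin p) (Fin p) ℝ) : matNorm M = ∑ j, colNorm M j :=
  Finset.sum_comm

lemma colNorm_nonneg (M : Matrix (Fin p) (Fin p) ℝ) (j : Fin p) : 0 ≤ colNorm M j :=
  Finset.sum_nonneg fun _ _ => abs_nonneg _

lemma colNorm_succ (hM : ∀ n, meanMatrix (g n) ∈ SPlus p B) (n : ℕ) (j : Fin p) :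
    colNorm (meanProd g (n + 1)) j = ∑ r, colNorm (meanProd g n) r * meanMatrix (g n) r j := by
  rw [colNorm_meanProd hM]
  simp_rw [colNorm_meanProd hM n, meanProd, Matrix.mul_apply, Finset.sum_mul]
  exact Finset.sum_comm

lemma colNorm_zero (j : Fin p) : colNorm (meanProd g 0) j = 1 := by
  simp [colNorm, meanProd, Matrix.one_apply, apply_ite abs]

lemma colNorm_pos (hM : ∀ n, meanMatrix (g n) ∈ SPlus p B) (n : ℕ) (j : Fin p) :
    0 < colNorm (meanProd g n) j := by
  induction n generalizing j with
  | zero => rw [colNorm_zero]; exact one_pos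
  | succ n ih =>
    rw [colNorm_succ hM]
    exact Finset.sum_pos (fun r _ => mul_pos (ih r) ((hM n).1 r j)) ⟨j, Finset.mem_univ j⟩

lemma meanMatrix_le_mul (hM : ∀ n, meanMatrix (g n) ∈ SPlus p B) (n : ℕ) (i j k l : Fin p) :
    meanMatrix (g n) i j ≤ B * meanMatrix (g n) k l :=
  (div_le_iff₀ ((hM n).1 k l)).1 ((hM n).2 i j k l).2

lemma colNorm_le_mul (hB : 1 < B) (hM : ∀ n, meanMatrix (g n) ∈ SPlus p B) (n : ℕ)
    (j k : Fin p) : colNorm (meanProd g n) j ≤ B * colNorm (meanProd g n) k := by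
  cases n with
  | zero => rw [colNorm_zero, colNorm_zero]; linarith
  | succ n =>
    rw [colNorm_succ hM, colNorm_succ hM, Finset.mul_sum]
    refine Finset.sum_le_sum fun r _ => ?_
    rw [mul_left_comm]
    exact mul_le_mul_of_nonneg_left (meanMatrix_le_mul hM n r j r k) (colNorm_nonneg _ _)

lemma colNorm_le_matNorm (M : Matrix (Fin p) (Fin p) ℝ) (j : Fin p) : colNorm M j ≤ matNorm M := by
  rw [matNorm_eq_sum_colNorm]
  exact Finset.single_le_sum (f := fun j => colNorm M j) (fun j _ => colNorm_nonneg M j)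
    (Finset.mem_univ j)

lemma matNorm_le_mul (hB : 1 < B) (hM : ∀ n, meanMatrix (g n) ∈ SPlus p B) (n : ℕ) (j : Fin p) :
    matNorm (meanProd g n) ≤ p * B * colNorm (meanProd g n) j := by
  rw [matNorm_eq_sum_colNorm]
  refine (Finset.sum_le_sum fun k _ => colNorm_le_mul hB hM n k j).trans ?_
  simp [mul_assoc]

lemma matNorm_pos (hp : 0 < p) (hM : ∀ n, meanMatrix (g n) ∈ SPlus p B) (n : ℕ) :
    0 < matNorm (meanProd g n) :=
  (colNorm_pos hM n ⟨0, hp⟩).trans_le (colNorm_le_matNorm _ _)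

lemma mul_matNorm_le (hp : 0 < p) (hε : 0 < ε) (hM : ∀ n, meanMatrix (g n) ∈ SPlus p B)
    (hG : ∀ n, g n ∈ GClass p ε K) (n : ℕ) :
    2 * ε * matNorm (meanProd g n) ≤ matNorm (meanProd g (n + 1)) := by
  refine le_trans ?_ (colNorm_le_matNorm _ ⟨0, hp⟩)
  rw [colNorm_succ hM, matNorm_eq_sum_colNorm, Finset.mul_sum]
  refine Finset.sum_le_sum fun r _ => ?_
  rw [mul_comm]
  exact mul_le_mul_of_nonneg_left (two_mul_le_meanMatrix hε hG n r _) (colNorm_nonneg _ _)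

lemma meanProd_succ_pos (hM : ∀ n, meanMatrix (g n) ∈ SPlus p B) (n : ℕ) (i j : Fin p) :
    0 < meanProd g (n + 1) i j := by
  induction n generalizing j with
  | zero =>
    rw [meanProd, meanProd, one_mul]
    exact (hM 0).1 i j
  | succ n ih =>
    rw [meanProd, Matrix.mul_apply]
    exact Finset.sum_pos (fun r _ => mul_pos (ih r) ((hM (n + 1)).1 r j)) ⟨i, Finset.mem_univ i⟩

lemma summable_inv_matNorm (hM : ∀ n, meanMatrix (g n) ∈ SPlus p B)
    (hMean : ∃ i j : Fin p, Summable fun n : ℕ => 1 / meanProd g (n + 1) i j) :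
    Summable fun n => 1 / matNorm (meanProd g (n + 1)) := by
  obtain ⟨i, j, h⟩ := hMean
  refine h.of_nonneg_of_le (fun n => ?_) fun n => ?_
  · exact one_div_nonneg.2 (matNorm_pos i.pos hM _).le
  · refine one_div_le_one_div_of_le (meanProd_succ_pos hM n i j) ?_
    refine le_trans ?_ (colNorm_le_matNorm _ j)
    rw [colNorm_meanProd hM]
    exact Finset.single_le_sum (f := fun i => meanProd g (n + 1) i j)
      (fun i _ => meanProd_nonneg hM _ i j) (Finset.mem_univ i)

/-- The mean size of the marked population, averaged with the reproductive weights. -/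
lemma sum_colNorm_mul_meanMatrix (hM : ∀ n, meanMatrix (g n) ∈ SPlus p B) (n : ℕ)
    (s : Fin p → ℝ) :
    ∑ i, colNorm (meanProd g n) i * ∑ j, meanMatrix (g n) i j * s j =
      ∑ j, colNorm (meanProd g (n + 1)) j * s j := by
  simp_rw [colNorm_succ hM, Finset.mul_sum, Finset.sum_mul]
  rw [Finset.sum_comm]
  simp_rw [mul_assoc]

/-- With `y` the weighted sum, the upper bound reads `y_n ≤ y_{n+1} (1 - c y_{n+1} / m_{n+1})`, so
`1/y` gains at least `c / m_{n+1}` per backward step. The product form also covers `y = 0`. -/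
lemma sum_colNorm_markIter_mul_le (hp : 0 < p) (hε : 0 < ε) (hK : 0 < K)
    (hM : ∀ n, meanMatrix (g n) ∈ SPlus p B)
    (hG : ∀ n, g n ∈ GClass p ε K) {s : Fin p → ℝ} (hs : ∀ j, s j ∈ Set.Icc (0 : ℝ) 1) (n d : ℕ) :
    ε / (K * p) * (∑ j, colNorm (meanProd g n) j * markIter g n d s j) *
      (∑ l ∈ Finset.range d, 1 / matNorm (meanProd g (n + 1 + l))) ≤ 1 := by
  induction d generalizing n with
  | zero => simp
  | succ d ih =>
    have ih := ih (n + 1)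
    set c := ε / (K * p) with hc
    have hp' : (0 : ℝ) < p := by exact_mod_cast hp
    have hc0 : 0 ≤ c := by positivity
    set s' := markIter g (n + 1) d s
    have hs' : ∀ j, s' j ∈ Set.Icc (0 : ℝ) 1 := markIter_mem hs _ _
    set y' := ∑ j, colNorm (meanProd g (n + 1)) j * s' j with hy'
    have hy0 : 0 ≤ y' := Finset.sum_nonneg fun j _ => mul_nonneg (colNorm_nonneg _ _) (hs' j).1
    set m := matNorm (meanProd g (n + 1)) with hm
    have hm0 : 0 < m := matNorm_pos hp hM _
    have h1 : y' ≤ m * ∑ j, s' j := by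
      rw [hy', Finset.mul_sum]
      exact Finset.sum_le_sum fun j _ =>
        mul_le_mul_of_nonneg_right (colNorm_le_matNorm _ _) (hs' j).1
    have h2 : ∑ j, colNorm (meanProd g n) j * markIter g n (d + 1) s j ≤
        y' * (1 - c * ∑ j, s' j) := by
      rw [hy', ← sum_colNorm_mul_meanMatrix hM, Finset.sum_mul]
      refine Finset.sum_le_sum fun i _ => ?_
      rw [mul_assoc]
      refine mul_le_mul_of_nonneg_left ?_ (colNorm_nonneg _ _)
      exact markProb_le_mul hp hε hK ((hG n).2.2 i) hs' ((hG n).1 i)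
    have h3 : y' * (1 - c * ∑ j, s' j) ≤ y' * (1 - c * y' / m) := by
      refine mul_le_mul_of_nonneg_left ?_ hy0
      have : c * y' / m ≤ c * ∑ j, s' j := by
        rw [div_le_iff₀ hm0]
        nlinarith
      linarith
    rw [Finset.sum_range_succ']
    have hshift : ∀ l, matNorm (meanProd g (n + 1 + (l + 1))) =
        matNorm (meanProd g (n + 1 + 1 + l)) := fun l => by
      rw [show n + 1 + (l + 1) = n + 1 + 1 + l by ring]
    simp_rw [hshift, add_zero]
    set T := ∑ l ∈ Finset.range d, 1 / matNorm (meanProd g (n + 1 + 1 + l)) with hT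
    have hT0 : 0 ≤ T := Finset.sum_nonneg fun l _ => one_div_nonneg.2 (matNorm_pos hp hM _).le
    set b := c * y' / m with hb
    have hb0 : 0 ≤ b := by positivity
    have h4 : 0 ≤ c * y' * T := mul_nonneg (mul_nonneg hc0 hy0) hT0
    -- With `x = c y' T ≤ 1`, one has `1 - (1 - b)(x + b) = (1 - x)(1 - b + b²) + x b²`; no bound `b
    -- ≤ 1` is needed.
    have h5 : (1 - b) * (c * y' * T + b) ≤ 1 := by
      have h5 : 0 ≤ 1 - b + b ^ 2 := by nlinarith [sq_nonneg (b - 1)]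
      linear_combination mul_nonneg (sub_nonneg.2 ih) h5 + mul_nonneg h4 (sq_nonneg b)
    have h6 : c * (y' * (1 - b)) * (T + 1 / m) = (1 - b) * (c * y' * T + b) := by rw [hb]; ring
    refine le_trans ?_ (h6.trans_le h5)
    exact mul_le_mul_of_nonneg_right (mul_le_mul_of_nonneg_left (h2.trans h3) hc0)
      (add_nonneg hT0 (one_div_nonneg.2 hm0.le))

/-- The lower bound on `markProb` makes `1/y` gain at most `C p B / m_{n+1}` per backward step. Here
`A` plays the role of an upper bound for `1/y` at the final generation. -/
lemma one_le_sum_colNorm_markIter_mul (hp : 0 < p) (hB : 1 < B) (hε : 0 < ε) (hK : 0 < K)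
    (hM : ∀ n, meanMatrix (g n) ∈ SPlus p B)
    (hG : ∀ n, g n ∈ GClass p ε K) {s : Fin p → ℝ} (hs : ∀ j, s j ∈ Set.Icc (0 : ℝ) 1)
    (A : ℝ) (n d : ℕ) (hA : 1 ≤ (∑ j, colNorm (meanProd g (n + d)) j * s j) * A) :
    1 ≤ (∑ j, colNorm (meanProd g n) j * markIter g n d s j) *
      (A + K / (2 * ε) * (p * B) *
        ∑ l ∈ Finset.range d, 1 / matNorm (meanProd g (n + 1 + l))) := by
  induction d generalizing n with
  | zero => simpa [markIter] using hA
  | succ d ih =>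
    have ih := ih (n + 1) (by rwa [add_right_comm, add_assoc])
    set C := K / (2 * ε) with hC
    have hC0 : 0 ≤ C := by positivity
    set s' := markIter g (n + 1) d s
    have hs' : ∀ j, s' j ∈ Set.Icc (0 : ℝ) 1 := markIter_mem hs _ _
    set y' := ∑ j, colNorm (meanProd g (n + 1)) j * s' j with hy'
    have hS0 : 0 ≤ ∑ j, s' j := Finset.sum_nonneg fun j _ => (hs' j).1
    set m := matNorm (meanProd g (n + 1)) with hm
    have hm0 : 0 < m := matNorm_pos hp hM _
    have h1 : ∑ j, s' j ≤ y' * (p * B) * (1 / m) := by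
      rw [mul_one_div, le_div_iff₀ hm0, hy', Finset.sum_mul, Finset.sum_mul]
      refine Finset.sum_le_sum fun j _ => ?_
      have := mul_le_mul_of_nonneg_left (matNorm_le_mul hB hM (n + 1) j) (hs' j).1
      linarith
    have hpos : 0 < 1 + C * ∑ j, s' j := by positivity
    have h2 : y' / (1 + C * ∑ j, s' j) ≤
        ∑ j, colNorm (meanProd g n) j * markIter g n (d + 1) s j := by
      rw [hy', ← sum_colNorm_mul_meanMatrix hM, Finset.sum_div]
      refine Finset.sum_le_sum fun i _ => ?_
      rw [mul_div_assoc]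
      refine mul_le_mul_of_nonneg_left ?_ (colNorm_nonneg _ _)
      exact div_le_markProb hε hK.le ((hG n).2.2 i) hs' ((hG n).1 i)
    rw [Finset.sum_range_succ']
    have hshift : ∀ l, matNorm (meanProd g (n + 1 + (l + 1))) =
        matNorm (meanProd g (n + 1 + 1 + l)) := fun l => by
      rw [show n + 1 + (l + 1) = n + 1 + 1 + l by ring]
    simp_rw [hshift, add_zero]
    set T := ∑ l ∈ Finset.range d, 1 / matNorm (meanProd g (n + 1 + 1 + l)) with hT
    have hy0 : 0 ≤ y' := Finset.sum_nonneg fun j _ => mul_nonneg (colNorm_nonneg _ _) (hs' j).1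
    -- No sign is assumed on `A`; the induction hypothesis `1 ≤ y' * (A + …)` with `y' ≥ 0` supplies
    -- it.
    have hQ : 0 ≤ A + C * (p * B) * (T + 1 / m) := by
      have h3 : 0 ≤ A + C * (p * B) * T := by
        by_contra h
        push Not at h
        nlinarith
      have : 0 ≤ C * (p * B) * (1 / m) := by positivity
      linarith
    refine le_trans ?_ (mul_le_mul_of_nonneg_right h2 hQ)
    rw [div_mul_eq_mul_div, le_div_iff₀ hpos]
    have := mul_le_mul_of_nonneg_left h1 hC0
    linarith

/-- One generation suffices to make ancestors of different types comparable: the marking probability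
lies between `(M s)_i / (1 + C p)` and `(M s)_i`, and the rows of `M` differ by a factor at most
`B`. -/
lemma markIter_le_mul (hB : 1 < B) (hε : 0 < ε) (hK : 0 < K)
    (hM : ∀ n, meanMatrix (g n) ∈ SPlus p B)
    (hG : ∀ n, g n ∈ GClass p ε K) {s : Fin p → ℝ} (hs : ∀ j, s j ∈ Set.Icc (0 : ℝ) 1)
    (n d : ℕ) (i k : Fin p) :
    markIter g n (d + 1) s i ≤ B * (1 + K / (2 * ε) * p) * markIter g n (d + 1) s k := by
  have hp := i.pos
  set C := K / (2 * ε) with hC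
  have hC0 : 0 ≤ C := by positivity
  set s' := markIter g (n + 1) d s with hs'_def
  have hs' : ∀ j, s' j ∈ Set.Icc (0 : ℝ) 1 := markIter_mem hs _ _
  have hS0 : 0 ≤ ∑ j, s' j := Finset.sum_nonneg fun j _ => (hs' j).1
  have hS1 : ∑ j, s' j ≤ p := (Finset.sum_le_sum fun j _ => (hs' j).2).trans (by simp)
  have h1 : markIter g n (d + 1) s i ≤ ∑ j, meanMatrix (g n) i j * s' j := by
    refine (markProb_le_mul hp hε hK ((hG n).2.2 i) hs' ((hG n).1 i)).trans ?_
    refine mul_le_of_le_one_right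
      (Finset.sum_nonneg fun j _ => mul_nonneg ((hM n).1 i j).le (hs' j).1) ?_
    have : 0 ≤ ε / (K * p) * ∑ j, s' j := by positivity
    linarith
  have h2 : ∑ j, meanMatrix (g n) i j * s' j ≤ B * ∑ j, meanMatrix (g n) k j * s' j := by
    rw [Finset.mul_sum]
    refine Finset.sum_le_sum fun j _ => ?_
    rw [← mul_assoc]
    exact mul_le_mul_of_nonneg_right (meanMatrix_le_mul hM n i j k j) (hs' j).1
  have h3 : ∑ j, meanMatrix (g n) k j * s' j ≤ (1 + C * p) * markIter g n (d + 1) s k := by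
    have h4 := div_le_markProb hε hK.le ((hG n).2.2 k) hs' ((hG n).1 k)
    rw [div_le_iff₀ (by positivity)] at h4
    refine h4.trans ?_
    rw [mul_comm]
    refine mul_le_mul_of_nonneg_right ?_ (markProb_mem hs').1
    gcongr
  calc _ ≤ _ := h1
    _ ≤ _ := h2
    _ ≤ B * ((1 + C * p) * markIter g n (d + 1) s k) := by gcongr
    _ = _ := by ring

/-- The chain is `(1 - c x)^k ≤ exp (-k c x) ≤ exp (-x / (1 - x)) ≤ 1 - x`; the middle inequality
uses `1 - x ≥ ε`. -/
lemma one_sub_mul_pow_le {x ε c : ℝ} {k : ℕ} (hε : 0 < ε) (hx1 : x ≤ 1 - ε)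
    (hx0 : 0 ≤ x) (hcx : c * x ≤ 1) (hk : 1 ≤ k * c * ε) : (1 - c * x) ^ k ≤ 1 - x := by
  have h1 : (1 - c * x) ^ k ≤ Real.exp (-(k * (c * x))) := by
    rw [← mul_neg, Real.exp_nat_mul]
    exact pow_le_pow_left₀ (by linarith) (Real.one_sub_le_exp_neg _) _
  have hpos : 0 < 1 - x := by linarith
  have h2 : Real.exp (-(k * (c * x))) ≤ Real.exp (-(x / (1 - x))) := by
    refine Real.exp_le_exp.2 (neg_le_neg ?_)
    rw [div_le_iff₀ hpos]
    have h3 : 1 * x ≤ k * c * ε * x := mul_le_mul_of_nonneg_right hk hx0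
    have hkc : 0 ≤ k * c * x := by
      by_contra h
      push Not at h
      nlinarith
    nlinarith
  refine h1.trans (h2.trans ?_)
  rw [Real.exp_neg]
  refine inv_le_of_inv_le₀ hpos ?_
  refine le_trans (le_of_eq ?_) (Real.add_one_le_exp _)
  field_simp
  ring

/-- Uniformly in the starting generation, the probability of having a late descendant that is marked
is of the order of the survival probability, for marks on one type with intensity of the order of
the inverse mean. -/
lemma exists_pow_markIter_le (hp : 0 < p) (hB : 1 < B) (hε : 0 < ε) (hK : 0 < K)
    (hM : ∀ n, meanMatrix (g n) ∈ SPlus p B) (hG : ∀ n, g n ∈ GClass p ε K) (j : Fin p) :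
    ∃ k : ℕ, ∀ n d : ℕ, ∀ r : Fin p,
      (1 - markIter g n (d + 1) (Pi.single j (1 - Real.exp
        (-(matNorm (meanProd g (n + 1)) / colNorm (meanProd g (n + (d + 1))) j)))) r) ^ k ≤
      1 - markIter g n (d + 1) (fun _ => 1) r := by
  set C := K / (2 * ε) with hC
  set c := ε / (K * p) with hc
  have hp' : (0 : ℝ) < p := by exact_mod_cast hp
  have hB0 : 0 < B := by linarith
  have hC0 : 0 < C := by positivity
  have hc0 : 0 < c := by positivity
  -- The terms of `C3` bound `1 / lam`, `1 / vN` and the accumulated gain by multiples of `T`. In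
  -- `D`, the factor `p * B` isolates type `r` in the weighted survival sum, `C3 / c` compares the
  -- two weighted sums, and `B * (1 + C * p)` returns to type `r` for the partial marking.
  set C3 := 1 + p * B + C * (p * B) with hC3
  have hC30 : 0 < C3 := by positivity
  set D := p * B * (C3 / c) * (B * (1 + C * p)) with hD
  have hD0 : 0 < D := by positivity
  obtain ⟨k, hk⟩ := exists_nat_ge (D / ε)
  refine ⟨k, fun n d r => ?_⟩
  set lam := matNorm (meanProd g (n + 1)) with hlam
  have hlam0 : 0 < lam := matNorm_pos hp hM _
  set vN := colNorm (meanProd g (n + (d + 1))) j with hvN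
  have hvN0 : 0 < vN := colNorm_pos hM _ _
  have hx0 : 0 < lam / vN := by positivity
  set u₀ : Fin p → ℝ := Pi.single j (1 - Real.exp (-(lam / vN))) with hu₀
  have hu : ∀ i, u₀ i ∈ Set.Icc (0 : ℝ) 1 := by
    intro i
    by_cases h : i = j
    · subst h
      rw [hu₀, Pi.single_eq_same]
      exact ⟨by linarith [Real.exp_le_one_iff.2 (neg_nonpos.2 hx0.le)],
        by linarith [Real.exp_pos (-(lam / vN))]⟩
    · rw [hu₀, Pi.single_eq_of_ne h]; simp
  have h1 : ∀ i : Fin p, (fun _ : Fin p => (1 : ℝ)) i ∈ Set.Icc (0 : ℝ) 1 := fun _ => by simp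
  set T := ∑ l ∈ Finset.range (d + 1), 1 / matNorm (meanProd g (n + 1 + l)) with hT
  have hTpos : ∀ l, 0 ≤ 1 / matNorm (meanProd g (n + 1 + l)) :=
    fun l => one_div_nonneg.2 (matNorm_pos hp hM _).le
  have hT1 : 1 / lam ≤ T := by
    have := Finset.single_le_sum (f := fun l => 1 / matNorm (meanProd g (n + 1 + l)))
      (fun l _ => hTpos l) (Finset.mem_range.2 (Nat.succ_pos d))
    simp only [add_zero] at this
    exact this
  have hT2 : 1 / vN ≤ p * B * T := by
    have h2 := Finset.single_le_sum (f := fun l => 1 / matNorm (meanProd g (n + 1 + l)))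
      (fun l _ => hTpos l) (Finset.mem_range.2 (Nat.lt_succ_self d))
    have h3 := matNorm_le_mul hB hM (n + (d + 1)) j
    have h4 : 1 / vN ≤ p * B * (1 / matNorm (meanProd g (n + (d + 1)))) := by
      rw [mul_one_div, div_le_div_iff₀ hvN0 (matNorm_pos hp hM _)]
      linarith
    refine h4.trans ?_
    rw [show n + (d + 1) = n + 1 + d by ring]
    gcongr
  have hT0 : 0 < T := (one_div_pos.2 hlam0).trans_le hT1
  -- With `x = lam / vN`, this is `(1 - exp (-x)) * (1 + x) / x ≥ 1`. Hence `1 / lam + 1 / vN` is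
  -- admissible as `A`.
  have hA : 1 ≤ (∑ i, colNorm (meanProd g (n + (d + 1))) i * u₀ i) * (1 / lam + 1 / vN) := by
    rw [Finset.sum_eq_single j (fun i _ hi => by rw [hu₀, Pi.single_eq_of_ne hi, mul_zero])
      (fun h => absurd (Finset.mem_univ j) h), hu₀, Pi.single_eq_same, ← hvN]
    set x := lam / vN with hx
    have h2 : Real.exp (-x) ≤ 1 / (1 + x) := by
      rw [Real.exp_neg, ← one_div]
      exact one_div_le_one_div_of_le (by linarith) (by linarith [Real.add_one_le_exp x])
    have h3 : vN * (1 - Real.exp (-x)) * (1 / lam + 1 / vN) = (1 - Real.exp (-x)) * ((1 + x) / x) := by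
      rw [hx]; field_simp
    rw [h3]
    have h4 : (1 - 1 / (1 + x)) * ((1 + x) / x) = 1 := by
      field_simp
      ring
    exact h4.symm.trans_le (mul_le_mul_of_nonneg_right (by linarith) (by positivity))
  set s := markIter g n (d + 1) (fun _ => 1) with hs
  set u := markIter g n (d + 1) u₀ with hu_def
  have hs01 : ∀ i, s i ∈ Set.Icc (0 : ℝ) 1 := markIter_mem h1 _ _
  have hu01 : ∀ i, u i ∈ Set.Icc (0 : ℝ) 1 := markIter_mem hu _ _
  have hU := sum_colNorm_markIter_mul_le hp hε hK hM hG h1 n (d + 1)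
  have hL := one_le_sum_colNorm_markIter_mul hp hB hε hK hM hG hu _ n (d + 1) hA
  rw [← hs, ← hT, ← hc] at hU
  rw [← hu_def, ← hT, ← hC] at hL
  set ys := ∑ j, colNorm (meanProd g n) j * s j with hys
  set yu := ∑ j, colNorm (meanProd g n) j * u j with hyu
  have hyu0 : 0 ≤ yu := Finset.sum_nonneg fun j _ => mul_nonneg (colNorm_nonneg _ _) (hu01 j).1
  have hsu : c * ys ≤ C3 * yu := by
    have h2 : 1 ≤ yu * (C3 * T) :=
      hL.trans (mul_le_mul_of_nonneg_left (by rw [hC3]; linarith) hyu0)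
    have h3 : c * ys * T ≤ C3 * yu * T := by linarith
    exact le_of_mul_le_mul_right h3 hT0
  set m := matNorm (meanProd g n) with hm
  have hm0 : 0 < m := matNorm_pos hp hM _
  have hsr : m * s r ≤ p * B * ys := by
    have h2 := Finset.single_le_sum (f := fun j => colNorm (meanProd g n) j * s j)
      (fun j _ => mul_nonneg (colNorm_nonneg _ _) (hs01 j).1) (Finset.mem_univ r)
    have h3 := mul_le_mul_of_nonneg_right (matNorm_le_mul hB hM n r) (hs01 r).1
    have h4 := mul_le_mul_of_nonneg_left h2 (show 0 ≤ p * B by positivity)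
    rw [← hys] at h4
    linarith
  have hur : yu ≤ m * (B * (1 + C * p) * u r) := by
    rw [hyu, hm, matNorm_eq_sum_colNorm, Finset.sum_mul]
    exact Finset.sum_le_sum fun i _ => mul_le_mul_of_nonneg_left
      (markIter_le_mul hB hε hK hM hG hu n d i r) (colNorm_nonneg _ _)
  have hfin : s r ≤ D * u r := by
    have h2 : ys ≤ C3 / c * yu := by
      rw [div_mul_eq_mul_div, le_div_iff₀ hc0]; linarith
    have h3 : m * s r ≤ m * (D * u r) :=
      calc m * s r ≤ p * B * ys := hsr
        _ ≤ p * B * (C3 / c * yu) := by gcongr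
        _ ≤ p * B * (C3 / c * (m * (B * (1 + C * p) * u r))) := by gcongr
        _ = m * (D * u r) := by rw [hD]; ring
    exact le_of_mul_le_mul_left h3 hm0
  have h5 : D⁻¹ * s r ≤ u r := by
    rw [inv_mul_le_iff₀ hD0]; exact hfin
  -- A childless first generation, of probability at least `ε`, keeps the survival probability away
  -- from `1`; this allows the factor `D` to be turned into an exponent.
  have h6 : s r ≤ 1 - ε :=
    markProb_le_one_sub (markIter_mem h1 _ _) hε.le ((hG n).2.1 r)
  refine le_trans (pow_le_pow_left₀ (by linarith [(hu01 r).2]) (sub_le_sub_left h5 1) k) ?_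
  refine one_sub_mul_pow_le hε h6 (hs01 r).1 (h5.trans (hu01 r).2) ?_
  rw [div_le_iff₀ hε] at hk
  rw [mul_right_comm, ← div_eq_mul_inv, le_div_iff₀ hD0]
  linarith

end Environment

/-! ### Moments and generating function of one reproduction step. -/

section Offspring

variable {p : ℕ} {Ω : Type*}

/-- The labels of the individuals of a generation composed of `z l` particles of each type `l`,
together with their types. -/
abbrev Labels (z : Fin p → ℕ) : Type :=
  Σ l : Fin p, ↥(Finset.Ico (∑ m ∈ Finset.Iio l, z m) (∑ m ∈ Finset.Iic l, z m))

/-- The composition of the generation `n + 1` if the generation `n` is composed of `z l` particles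
of each type `l`. -/
def offspringSum (ξ : ℕ → ℕ → Ω → Fin p → Fin p → ℕ) (n : ℕ) (z : Fin p → ℕ) (ω : Ω)
    (j : Fin p) : ℕ :=
  ∑ l, ∑ k ∈ Finset.Ico (∑ m ∈ Finset.Iio l, z m) (∑ m ∈ Finset.Iic l, z m), ξ n k ω l j

lemma gwProcess_succ (ξ : ℕ → ℕ → Ω → Fin p → Fin p → ℕ) (n : ℕ) (ω : Ω) (i : Fin p) :
    gwProcess ξ (n + 1) ω i = offspringSum ξ n (gwProcess ξ n ω i) ω := rfl

lemma offspringSum_eq (ξ : ℕ → ℕ → Ω → Fin p → Fin p → ℕ) (n : ℕ) (z : Fin p → ℕ) (ω : Ω)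
    (j : Fin p) : offspringSum ξ n z ω j = ∑ x : Labels z, ξ n x.2 ω x.1 j := by
  rw [offspringSum, Fintype.sum_sigma]
  exact Finset.sum_congr rfl fun l _ => (Finset.sum_coe_sort _ fun k => ξ n k ω l j).symm

lemma offspringSum_dot (ξ : ℕ → ℕ → Ω → Fin p → Fin p → ℕ) (n : ℕ) (z : Fin p → ℕ) (a : Fin p → ℝ) (ω : Ω) :
    ∑ j, (offspringSum ξ n z ω j : ℝ) * a j =
      ∑ x : Labels z, ∑ j, (ξ n x.2 ω x.1 j : ℝ) * a j := by
  simp_rw [offspringSum_eq, Nat.cast_sum, Finset.sum_mul]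
  exact Finset.sum_comm

lemma card_label (z : Fin p → ℕ) (l : Fin p) :
    (Finset.Ico (∑ m ∈ Finset.Iio l, z m) (∑ m ∈ Finset.Iic l, z m)).card = z l := by
  rw [Nat.card_Ico, ← Finset.Iio_insert, Finset.sum_insert (by simp)]
  omega

lemma sum_labels (z : Fin p → ℕ) (f : Fin p → ℝ) :
    ∑ x : Labels z, f x.1 = ∑ l, (z l : ℝ) * f l := by
  rw [Fintype.sum_sigma]
  refine Finset.sum_congr rfl fun l _ => ?_
  rw [Finset.sum_const (f l), nsmul_eq_mul, Finset.card_univ, Fintype.card_coe, card_label]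

lemma prod_labels (z : Fin p → ℕ) (f : Fin p → ℝ) :
    ∏ x : Labels z, f x.1 = ∏ l, f l ^ z l := by
  rw [Fintype.prod_sigma]
  refine Finset.prod_congr rfl fun l _ => ?_
  rw [Finset.prod_const (f l), Finset.card_univ, Fintype.card_coe, card_label]

lemma label_injective (z : Fin p → ℕ) : Function.Injective fun x : Labels z => (x.2 : ℕ) := by
  have key : ∀ x y : Labels z, x.1 < y.1 → (x.2 : ℕ) ≠ y.2 := by
    intro x y h
    have h1 := (Finset.mem_Ico.1 x.2.2).2
    have h2 := (Finset.mem_Ico.1 y.2.2).1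
    have h3 : ∑ m ∈ Finset.Iic x.1, z m ≤ ∑ m ∈ Finset.Iio y.1, z m :=
      Finset.sum_le_sum_of_subset fun m hm =>
        Finset.mem_Iio.2 ((Finset.mem_Iic.1 hm).trans_lt h)
    omega
  rintro ⟨l, k⟩ ⟨l', k'⟩ h
  rcases lt_trichotomy l l' with hl | rfl | hl
  · exact absurd h (key _ _ hl)
  · simp only at h
    rw [Subtype.ext h]
  · exact absurd h.symm (key _ _ hl)

/-- The σ-algebra generated by the offspring in the generations in `s`. -/
abbrev offspringSigma (ξ : ℕ → ℕ → Ω → Fin p → Fin p → ℕ) (s : Set ℕ) : MeasurableSpace Ω :=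
  ⨆ nk ∈ {nk : ℕ × ℕ | nk.1 ∈ s}, MeasurableSpace.comap (ξ nk.1 nk.2) inferInstance

lemma measurable_offspringSigma (ξ : ℕ → ℕ → Ω → Fin p → Fin p → ℕ) {s : Set ℕ} {n : ℕ}
    (hn : n ∈ s) (k : ℕ) : Measurable[offspringSigma ξ s] (ξ n k) :=
  (comap_measurable (ξ n k)).mono
    (le_iSup₂_of_le (f := fun (nk : ℕ × ℕ) (_ : nk ∈ {nk : ℕ × ℕ | nk.1 ∈ s}) =>
      MeasurableSpace.comap (ξ nk.1 nk.2) inferInstance) (n, k) hn le_rfl) le_rfl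

variable [MeasurableSpace Ω] {μ : Measure Ω} {g : ℕ → OffspringLaw p}
  {ξ : ℕ → ℕ → Ω → Fin p → Fin p → ℕ} {ε K : ℝ}

lemma IsOffspringFamily.measurable_row (hξ : IsOffspringFamily μ g ξ) (n k : ℕ) (l : Fin p) :
    Measurable fun ω => ξ n k ω l := (measurable_pi_apply l).comp (hξ.measurable n k)

/-- Distinct particles have distinct numbers and so read rows of distinct matrices; the joint law of
the rows of one matrix never enters. -/
lemma IsOffspringFamily.iIndepFun_labels (hξ : IsOffspringFamily μ g ξ) (n : ℕ) (z : Fin p → ℕ) :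
    iIndepFun (fun (x : Labels z) ω => ξ n x.2 ω x.1) μ := by
  have h := hξ.indep.precomp (g := fun x : Labels z => (n, (x.2 : ℕ)))
    fun x y hxy => label_injective z (Prod.ext_iff.1 hxy).2
  exact h.comp (fun x α => α x.1) fun x => measurable_pi_apply _

lemma measurable_offspringSum {n : ℕ} (h : ∀ k, Measurable (ξ n k)) (z : Fin p → ℕ) :
    Measurable (offspringSum ξ n z) := by
  refine measurable_pi_lambda _ fun j => ?_
  simp_rw [offspringSum_eq]
  exact Finset.measurable_sum _ fun x _ =>
    (measurable_pi_apply j).comp ((measurable_pi_apply x.1).comp (h x.2))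

/-- Only generations before `n` are assumed measurable, so that the σ-algebra on `Ω` may be taken to
be the one generated by the past. -/
lemma measurable_gwProcess {n : ℕ} (h : ∀ m < n, ∀ k, Measurable (ξ m k)) (i : Fin p) :
    Measurable fun ω => gwProcess ξ n ω i := by
  induction n with
  | zero => exact measurable_const
  | succ n ih =>
    have h2 : Measurable fun q : (Fin p → ℕ) × Ω => offspringSum ξ n q.1 q.2 :=
      measurable_from_prod_countable_right fun z =>
        measurable_offspringSum (h n (Nat.lt_succ_self n)) z
    have ih := ih fun m hm => h m (hm.trans (Nat.lt_succ_self n))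
    have h3 : (fun ω => gwProcess ξ (n + 1) ω i) =
        (fun q : (Fin p → ℕ) × Ω => offspringSum ξ n q.1 q.2) ∘
          fun ω => (gwProcess ξ n ω i, ω) := by
      ext ω
      rw [gwProcess_succ]
      rfl
    rw [h3]
    exact h2.comp (ih.prodMk measurable_id)

lemma measurable_gwProcess_pair {k n : ℕ} (hkn : k ≤ n) (h : ∀ m < n, ∀ k, Measurable (ξ m k))
    (i : Fin p) : Measurable fun ω => (gwProcess ξ k ω i, gwProcess ξ n ω i) :=
  (measurable_gwProcess (fun m hm => h m (hm.trans_le hkn)) i).prodMk (measurable_gwProcess h i)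

lemma integral_row (hξ : IsOffspringFamily μ g ξ) (n k : ℕ) (l : Fin p) (f : (Fin p → ℕ) → ℝ) :
    ∫ ω, f (ξ n k ω l) ∂μ = ∫ α, f α ∂(g n l).toMeasure := by
  rw [← hξ.law n k l, integral_map (hξ.measurable_row n k l).aemeasurable
    Measurable.of_discrete.aestronglyMeasurable]

lemma integrable_row (hξ : IsOffspringFamily μ g ξ) (n k : ℕ) (l : Fin p) {f : (Fin p → ℕ) → ℝ}
    (hf : Integrable f (g n l).toMeasure) : Integrable (fun ω => f (ξ n k ω l)) μ := by
  rw [← hξ.law n k l] at hf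
  exact hf.comp_measurable (hξ.measurable_row n k l)

lemma integral_prod_offspringSum [IsProbabilityMeasure μ] (hξ : IsOffspringFamily μ g ξ) (n : ℕ)
    (z : Fin p → ℕ) {s : Fin p → ℝ} (hs : ∀ j, s j ∈ Set.Icc (0 : ℝ) 1) :
    ∫ ω, ∏ j, (1 - s j) ^ offspringSum ξ n z ω j ∂μ =
      ∏ l, (1 - markProb (g n l).toMeasure s) ^ z l := by
  simp_rw [offspringSum_eq, ← Finset.prod_pow_eq_pow_sum]
  rw [← prod_labels z fun l => 1 - markProb (g n l).toMeasure s]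
  calc ∫ ω, ∏ j, ∏ x : Labels z, (1 - s j) ^ ξ n x.2 ω x.1 j ∂μ
      = ∫ ω, ∏ x : Labels z, ∏ j, (1 - s j) ^ ξ n x.2 ω x.1 j ∂μ := by
        congr 1; ext ω; exact Finset.prod_comm
    _ = ∏ x : Labels z, ∫ ω, ∏ j, (1 - s j) ^ ξ n x.2 ω x.1 j ∂μ := by
        have hind := (hξ.iIndepFun_labels n z).comp
          (fun _ (α : Fin p → ℕ) => ∏ j, (1 - s j) ^ α j) fun _ => Measurable.of_discrete
        refine hind.integral_fun_prod_eq_prod_integral fun x => ?_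
        exact ((Measurable.of_discrete (f := fun α : Fin p → ℕ => ∏ j, (1 - s j) ^ α j)).comp
          (hξ.measurable_row n x.2 x.1)).aestronglyMeasurable
    _ = _ := by
        refine Finset.prod_congr rfl fun x _ => ?_
        rw [integral_row hξ n x.2 x.1 (fun α => ∏ j, (1 - s j) ^ α j),
          integral_prod_one_sub_pow hs]

lemma integral_offspringSum_dot (hξ : IsOffspringFamily μ g ξ)
    (hG : ∀ n, g n ∈ GClass p ε K) (n : ℕ) (z : Fin p → ℕ) (a : Fin p → ℝ) :
    Integrable (fun ω => ∑ j, (offspringSum ξ n z ω j : ℝ) * a j) μ ∧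
    ∫ ω, ∑ j, (offspringSum ξ n z ω j : ℝ) * a j ∂μ =
      ∑ l, (z l : ℝ) * (meanMatrix (g n)).mulVec a l := by
  simp_rw [offspringSum_dot]
  have hi : ∀ x : Labels z, Integrable (fun ω => ∑ j, (ξ n x.2 ω x.1 j : ℝ) * a j) μ :=
    fun x => integrable_row hξ n x.2 x.1 (integrable_dot ((hG n).2.2 x.1) a)
  refine ⟨integrable_finsetSum _ fun x _ => hi x, ?_⟩
  rw [integral_finsetSum _ fun x _ => hi x, ← sum_labels z fun l => (meanMatrix (g n)).mulVec a l]
  refine Finset.sum_congr rfl fun x _ => ?_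
  rw [integral_row hξ n x.2 x.1 (fun α => ∑ j, (α j : ℝ) * a j), integral_dot ((hG n).2.2 x.1)]
  rfl

/-- Second moment equals squared mean plus variance; the variance is a sum over independent
particles, each contributing at most `A ^ 2 * K`. -/
lemma integral_offspringSum_dot_sq_le [IsProbabilityMeasure μ] (hξ : IsOffspringFamily μ g ξ)
    (hK : 0 ≤ K) (hG : ∀ n, g n ∈ GClass p ε K) (n : ℕ) (z : Fin p → ℕ) {a : Fin p → ℝ} {A : ℝ}
    (ha : ∀ j, |a j| ≤ A) (y : ℝ) :
    Integrable (fun ω => (∑ j, (offspringSum ξ n z ω j : ℝ) * a j + y) ^ 2) μ ∧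
    ∫ ω, (∑ j, (offspringSum ξ n z ω j : ℝ) * a j + y) ^ 2 ∂μ ≤
      (∑ l, (z l : ℝ) * (meanMatrix (g n)).mulVec a l + y) ^ 2 + A ^ 2 * K * ∑ l, (z l : ℝ) := by
  obtain ⟨hint, hmean⟩ := integral_offspringSum_dot hξ hG n z a
  set X : Labels z → Ω → ℝ := fun x ω => ∑ j, (ξ n x.2 ω x.1 j : ℝ) * a j with hX
  have hXm : ∀ x, AEStronglyMeasurable (X x) μ := fun x =>
    ((Measurable.of_discrete (f := fun α : Fin p → ℕ => ∑ j, (α j : ℝ) * a j)).comp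
      (hξ.measurable_row n x.2 x.1)).aestronglyMeasurable
  have hXL : ∀ x, MemLp (X x) 2 μ := fun x => (memLp_two_iff_integrable_sq (hXm x)).2
    (integrable_row hξ n x.2 x.1 (integrable_dot_sq ((hG n).2.2 x.1) a))
  set S : Ω → ℝ := fun ω => ∑ j, (offspringSum ξ n z ω j : ℝ) * a j with hS
  have hSX : S = ∑ x, X x := by
    ext ω
    rw [Finset.sum_apply]
    exact offspringSum_dot ξ n z a ω
  have hSL : MemLp S 2 μ := by
    rw [hSX]; exact memLp_finsetSum' _ fun x _ => hXL x
  have hSyL : MemLp (fun ω => S ω + y) 2 μ := hSL.add (memLp_const y)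
  have hvar : variance S μ ≤ A ^ 2 * K * ∑ l, (z l : ℝ) := by
    have hind := (hξ.iIndepFun_labels n z).comp (fun _ α => ∑ j, (α j : ℝ) * a j)
      fun _ => Measurable.of_discrete
    rw [hSX, IndepFun.variance_sum (fun x _ => hXL x) fun x _ y _ hxy => hind.indepFun hxy]
    have h1 : ∀ x : Labels z, variance (X x) μ ≤ A ^ 2 * K := fun x => by
      refine (variance_le_expectation_sq (hXm x)).trans ?_
      refine le_trans (le_of_eq ?_) (integral_dot_sq_le hK ((hG n).2.2 x.1) ha)
      exact integral_row hξ n x.2 x.1 (fun α => (∑ j, (α j : ℝ) * a j) ^ 2)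
    refine (Finset.sum_le_sum fun x _ => h1 x).trans (le_of_eq ?_)
    rw [sum_labels z fun _ => A ^ 2 * K, ← Finset.sum_mul, mul_comm]
  refine ⟨hSyL.integrable_sq, ?_⟩
  have h2 := variance_eq_sub hSyL
  rw [variance_add_const hSL.aestronglyMeasurable] at h2
  have h3 : ∫ ω, (S ω + y) ∂μ = ∑ l, (z l : ℝ) * (meanMatrix (g n)).mulVec a l + y := by
    rw [integral_add hint (integrable_const y), hmean]
    simp
  rw [h3] at h2
  simp only [Pi.pow_apply] at h2
  linarith

end Offspring

/-! ### Markov property, generating function and moments of the process. -/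

section Evolution

variable {p : ℕ} {Ω : Type*} [mΩ : MeasurableSpace Ω] {μ : Measure Ω} {g : ℕ → OffspringLaw p}
  {ξ : ℕ → ℕ → Ω → Fin p → Fin p → ℕ} {B ε K : ℝ}

/-- The past depends on generations below `n`, while the random map `z ↦ offspringSum ξ n z` depends
on generation `n` alone. The earlier state `Z_k` is carried along for the L² increments, which
compare with a function of it. -/
lemma indepFun_past [IsProbabilityMeasure μ] (hξ : IsOffspringFamily μ g ξ) {k n : ℕ}
    (hkn : k ≤ n) (i : Fin p) :
    IndepFun (fun ω => (gwProcess ξ k ω i, gwProcess ξ n ω i))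
      (fun ω z => offspringSum ξ n z ω) μ := by
  have hind0 : iIndep (fun nk : ℕ × ℕ => MeasurableSpace.comap (ξ nk.1 nk.2) inferInstance) μ :=
    hξ.indep
  have hind : Indep (offspringSigma ξ (Set.Iio n)) (offspringSigma ξ {n}) μ := by
    have hd : Disjoint {nk : ℕ × ℕ | nk.1 ∈ Set.Iio n} {nk : ℕ × ℕ | nk.1 ∈ ({n} : Set ℕ)} := by
      rw [Set.disjoint_left]
      rintro nk h1 h2
      exact absurd (Set.mem_singleton_iff.1 h2) (ne_of_lt h1)
    have hle : ∀ nk : ℕ × ℕ, MeasurableSpace.comap (ξ nk.1 nk.2) inferInstance ≤ mΩ :=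
      fun nk => (hξ.measurable nk.1 nk.2).comap_le
    exact indep_iSup_of_disjoint (m := fun nk : ℕ × ℕ =>
      MeasurableSpace.comap (ξ nk.1 nk.2) inferInstance) hle hind0 hd
  have h1 : Measurable[offspringSigma ξ {n}] fun ω z => offspringSum ξ n z ω :=
    @measurable_pi_lambda _ _ _ (offspringSigma ξ {n}) _ _ fun z =>
      @measurable_offspringSum p Ω (offspringSigma ξ {n}) ξ n
        (fun k => measurable_offspringSigma ξ (Set.mem_singleton n) k) z
  have h2 : Measurable[offspringSigma ξ (Set.Iio n)]
      fun ω => (gwProcess ξ k ω i, gwProcess ξ n ω i) :=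
    @measurable_gwProcess_pair p Ω (offspringSigma ξ (Set.Iio n)) ξ k n hkn
      (fun m hm k => measurable_offspringSigma ξ (Set.mem_Iio.2 hm) k) i
  exact indep_of_indep_of_le_left (indep_of_indep_of_le_right hind h1.comap_le) h2.comap_le

/-- The Markov property: the next generation may be resampled. -/
lemma lintegral_gwProcess_succ [IsProbabilityMeasure μ] (hξ : IsOffspringFamily μ g ξ) {k n : ℕ}
    (hkn : k ≤ n) (i : Fin p) (F : (Fin p → ℕ) → (Fin p → ℕ) → ℝ≥0∞) :
    ∫⁻ ω, F (gwProcess ξ k ω i) (gwProcess ξ (n + 1) ω i) ∂μ =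
      ∫⁻ ω, ∫⁻ ω', F (gwProcess ξ k ω i) (offspringSum ξ n (gwProcess ξ n ω i) ω') ∂μ ∂μ := by
  set U : Ω → (Fin p → ℕ) × (Fin p → ℕ) := fun ω => (gwProcess ξ k ω i, gwProcess ξ n ω i) with hU
  set V : Ω → (Fin p → ℕ) → (Fin p → ℕ) := fun ω z => offspringSum ξ n z ω with hV
  have hUm : Measurable U := measurable_gwProcess_pair hkn (fun m _ k => hξ.measurable m k) i
  have hVm : Measurable V := measurable_pi_lambda _ fun z => measurable_offspringSum (hξ.measurable n) z
  have hmap := (indepFun_iff_map_prod_eq_prod_map_map hUm.aemeasurable hVm.aemeasurable).1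
    (indepFun_past hξ hkn i)
  set H : ((Fin p → ℕ) × (Fin p → ℕ)) × ((Fin p → ℕ) → (Fin p → ℕ)) → ℝ≥0∞ :=
    fun q => F q.1.1 (q.2 q.1.2) with hH
  -- Evaluating a random map at a random point is measurable because the point ranges over a
  -- countable set.
  have hHm : Measurable H := measurable_from_prod_countable_right fun u =>
    (Measurable.of_discrete (f := F u.1)).comp (measurable_pi_apply u.2)
  have : Measurable fun u => ∫⁻ v, H (u, v) ∂(μ.map V) := Measurable.of_discrete
  calc ∫⁻ ω, F (gwProcess ξ k ω i) (gwProcess ξ (n + 1) ω i) ∂μ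
      = ∫⁻ ω, H (U ω, V ω) ∂μ := rfl
    _ = ∫⁻ q, H q ∂(μ.map fun ω => (U ω, V ω)) := (lintegral_map hHm (hUm.prodMk hVm)).symm
    _ = ∫⁻ u, ∫⁻ v, H (u, v) ∂(μ.map V) ∂(μ.map U) := by
        have : IsProbabilityMeasure (μ.map V) := Measure.isProbabilityMeasure_map hVm.aemeasurable
        rw [hmap, lintegral_prod _ hHm.aemeasurable]
    _ = ∫⁻ ω, ∫⁻ v, H (U ω, v) ∂(μ.map V) ∂μ := lintegral_map this hUm
    _ = _ := lintegral_congr fun ω => lintegral_map (hHm.comp measurable_prodMk_left) hVm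

/-- The generating function of the process. -/
lemma lintegral_prod_one_sub_pow [IsProbabilityMeasure μ] (hξ : IsOffspringFamily μ g ξ)
    {s : Fin p → ℝ} (hs : ∀ j, s j ∈ Set.Icc (0 : ℝ) 1) (n d : ℕ) (i : Fin p) :
    ∫⁻ ω, ENNReal.ofReal (∏ j, (1 - s j) ^ gwProcess ξ (n + d) ω i j) ∂μ =
      ∫⁻ ω, ENNReal.ofReal (∏ j, (1 - markIter g n d s j) ^ gwProcess ξ n ω i j) ∂μ := by
  induction d generalizing n with
  | zero => rfl
  | succ d ih =>
    rw [show n + (d + 1) = n + 1 + d by ring, ih (n + 1)]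
    have hs' := markIter_mem (g := g) hs (n + 1) d
    rw [lintegral_gwProcess_succ hξ le_rfl i fun _ z =>
      ENNReal.ofReal (∏ j, (1 - markIter g (n + 1) d s j) ^ z j)]
    refine lintegral_congr fun ω => ?_
    rw [← ofReal_integral_eq_lintegral_ofReal, integral_prod_offspringSum hξ n _ hs']
    · rfl
    · refine Integrable.of_bound (C := 1)
        ((Measurable.of_discrete (f := fun α : Fin p → ℕ =>
          ∏ j, (1 - markIter g (n + 1) d s j) ^ α j)).comp
            (measurable_offspringSum (hξ.measurable n) _)).aestronglyMeasurable (ae_of_all _ fun ω' => ?_)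
      have := prod_one_sub_pow_mem hs' (offspringSum ξ n (gwProcess ξ n ω i) ω')
      rw [Real.norm_eq_abs, abs_of_nonneg this.1]
      exact this.2
    · exact ae_of_all _ fun ω' => (prod_one_sub_pow_mem hs' _).1

lemma lintegral_gwProcess_dot [IsProbabilityMeasure μ] (hξ : IsOffspringFamily μ g ξ)
    (hM : ∀ n, meanMatrix (g n) ∈ SPlus p B) (hG : ∀ n, g n ∈ GClass p ε K)
    {a : Fin p → ℝ} (ha : ∀ j, 0 ≤ a j) (n : ℕ) (i : Fin p) :
    ∫⁻ ω, ENNReal.ofReal (∑ j, (gwProcess ξ n ω i j : ℝ) * a j) ∂μ =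
      ENNReal.ofReal ((meanProd g n).mulVec a i) := by
  induction n generalizing a with
  | zero => simp [gwProcess, meanProd]
  | succ n ih =>
    rw [lintegral_gwProcess_succ hξ le_rfl i fun _ z => ENNReal.ofReal (∑ j, (z j : ℝ) * a j),
      meanProd, ← Matrix.mulVec_mulVec, ← ih (a := (meanMatrix (g n)).mulVec a) fun j => by
        change 0 ≤ ∑ l, meanMatrix (g n) j l * a l
        exact Finset.sum_nonneg fun l _ => mul_nonneg ((hM n).1 j l).le (ha l)]
    refine lintegral_congr fun ω => ?_
    obtain ⟨h1, h2⟩ := integral_offspringSum_dot hξ hG n (gwProcess ξ n ω i) a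
    rw [← ofReal_integral_eq_lintegral_ofReal h1 (ae_of_all _ fun ω' =>
      Finset.sum_nonneg fun j _ => mul_nonneg (Nat.cast_nonneg _) (ha j)), h2]

lemma lintegral_popSize_le [IsProbabilityMeasure μ] (hξ : IsOffspringFamily μ g ξ)
    (hM : ∀ n, meanMatrix (g n) ∈ SPlus p B) (hG : ∀ n, g n ∈ GClass p ε K) (n : ℕ) (i : Fin p) :
    ∫⁻ ω, ENNReal.ofReal (∑ j, (gwProcess ξ n ω i j : ℝ)) ∂μ ≤
      ENNReal.ofReal (matNorm (meanProd g n)) := by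
  have h := lintegral_gwProcess_dot hξ hM hG (a := fun _ => 1) (fun _ => zero_le_one) n i
  simp only [mul_one] at h
  rw [h]
  refine ENNReal.ofReal_le_ofReal ?_
  simp only [Matrix.mulVec, dotProduct, mul_one]
  refine (Finset.sum_le_sum fun j _ => le_abs_self _).trans ?_
  exact Finset.single_le_sum (f := fun i => ∑ j, |meanProd g n i j|)
    (fun i _ => Finset.sum_nonneg fun _ _ => abs_nonneg _) (Finset.mem_univ i)

lemma lintegral_sq_succ_le [IsProbabilityMeasure μ] (hξ : IsOffspringFamily μ g ξ)
    (hK : 0 ≤ K) (hM : ∀ n, meanMatrix (g n) ∈ SPlus p B) (hG : ∀ n, g n ∈ GClass p ε K)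
    {k n : ℕ} (hkn : k ≤ n) (i : Fin p) {a : Fin p → ℝ} {A : ℝ}
    (ha : ∀ j, |a j| ≤ A) (y : (Fin p → ℕ) → ℝ) :
    ∫⁻ ω, ENNReal.ofReal ((∑ j, (gwProcess ξ (n + 1) ω i j : ℝ) * a j +
      y (gwProcess ξ k ω i)) ^ 2) ∂μ ≤
    ∫⁻ ω, ENNReal.ofReal ((∑ j, (gwProcess ξ n ω i j : ℝ) * (meanMatrix (g n)).mulVec a j +
      y (gwProcess ξ k ω i)) ^ 2) ∂μ + ENNReal.ofReal (A ^ 2 * K * matNorm (meanProd g n)) := by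
  rw [lintegral_gwProcess_succ hξ hkn i fun u z =>
    ENNReal.ofReal ((∑ j, (z j : ℝ) * a j + y u) ^ 2)]
  have hAK : 0 ≤ A ^ 2 * K := by positivity
  have hmZ : Measurable fun ω => ENNReal.ofReal (∑ j, (gwProcess ξ n ω i j : ℝ)) :=
    (Measurable.of_discrete (f := fun z : Fin p → ℕ => ENNReal.ofReal (∑ j, (z j : ℝ)))).comp
      (measurable_gwProcess (fun m _ k => hξ.measurable m k) i)
  calc _ ≤ ∫⁻ ω, (ENNReal.ofReal ((∑ j, (gwProcess ξ n ω i j : ℝ) *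
        (meanMatrix (g n)).mulVec a j + y (gwProcess ξ k ω i)) ^ 2) +
        ENNReal.ofReal (A ^ 2 * K) * ENNReal.ofReal (∑ j, (gwProcess ξ n ω i j : ℝ))) ∂μ := by
        refine lintegral_mono fun ω => ?_
        obtain ⟨h1, h2⟩ := integral_offspringSum_dot_sq_le hξ hK hG n (gwProcess ξ n ω i) ha
          (y (gwProcess ξ k ω i))
        rw [← ofReal_integral_eq_lintegral_ofReal h1 (ae_of_all _ fun ω' => sq_nonneg _),
          ← ENNReal.ofReal_mul hAK, ← ENNReal.ofReal_add (sq_nonneg _)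
            (mul_nonneg hAK (Finset.sum_nonneg fun _ _ => Nat.cast_nonneg _))]
        exact ENNReal.ofReal_le_ofReal h2
    _ ≤ _ := by
        rw [lintegral_add_right _ (hmZ.const_mul _), lintegral_const_mul _ hmZ,
          ENNReal.ofReal_mul hAK]
        gcongr
        exact lintegral_popSize_le hξ hM hG n i

lemma memLp_gwProcess_dot [IsProbabilityMeasure μ] (hξ : IsOffspringFamily μ g ξ)
    (hK : 0 ≤ K) (hM : ∀ n, meanMatrix (g n) ∈ SPlus p B) (hG : ∀ n, g n ∈ GClass p ε K)
    (n : ℕ) (i : Fin p) (a : Fin p → ℝ) :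
    MemLp (fun ω => ∑ j, (gwProcess ξ n ω i j : ℝ) * a j) 2 μ := by
  have hm : Measurable fun ω => ∑ j, (gwProcess ξ n ω i j : ℝ) * a j :=
    (Measurable.of_discrete (f := fun z : Fin p → ℕ => ∑ j, (z j : ℝ) * a j)).comp
      (measurable_gwProcess (fun m _ k => hξ.measurable m k) i)
  rw [memLp_two_iff_integrable_sq hm.aestronglyMeasurable]
  refine ⟨(hm.pow_const 2).aestronglyMeasurable, ?_⟩
  rw [hasFiniteIntegral_iff_ofReal (ae_of_all _ fun _ => sq_nonneg _)]
  clear hm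
  induction n generalizing a with
  | zero => simp [gwProcess]
  | succ n ih =>
    have h := lintegral_sq_succ_le hξ hK hM hG (le_refl n) i (a := a) (A := ∑ j, |a j|)
      (fun j => Finset.single_le_sum (f := fun j => |a j|) (fun _ _ => abs_nonneg _)
        (Finset.mem_univ j)) (fun _ => 0)
    simp only [add_zero] at h
    exact h.trans_lt (ENNReal.add_lt_top.2 ⟨ih _, ENNReal.ofReal_lt_top⟩)

end Evolution

/-! ### Analytic tools: merging of averages, common limits, L² norms. -/

/-- Iterated averages with weights bounded below merge. -/
lemma exists_tendsto_of_averaging {ι : Type*} [Fintype ι] [Nonempty ι] (x : ℕ → ι → ℝ)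
    (w : ℕ → ι → ι → ℝ) {δ : ℝ} (hδ : 0 < δ) (hw : ∀ n j r, δ ≤ w n j r)
    (hw1 : ∀ n j, ∑ r, w n j r = 1) (hx : ∀ n j, x (n + 1) j = ∑ r, w n j r * x n r) :
    ∃ h, ∀ j, Tendsto (fun n => x n j) atTop (𝓝 h) := by
  choose top htop using fun n => Finite.exists_max (x n)
  choose bot hbot using fun n => Finite.exists_min (x n)
  -- Every average puts weight at least `δ` on the minimiser, so the oscillation shrinks by the
  -- factor `1 - δ`.
  have hup : ∀ n j, x (n + 1) j ≤ x n (top n) - δ * (x n (top n) - x n (bot n)) := by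
    intro n j
    have h1 : ∑ r, w n j r * (x n (top n) - x n r) = x n (top n) - x (n + 1) j := by
      rw [hx]
      simp_rw [mul_sub]
      rw [Finset.sum_sub_distrib, ← Finset.sum_mul, hw1, one_mul]
    have h2 : w n j (bot n) * (x n (top n) - x n (bot n)) ≤
        ∑ r, w n j r * (x n (top n) - x n r) :=
      Finset.single_le_sum (f := fun r => w n j r * (x n (top n) - x n r))
        (fun r _ => mul_nonneg (hδ.le.trans (hw n j r)) (sub_nonneg.2 (htop n r)))
        (Finset.mem_univ _)
    have h3 := mul_le_mul_of_nonneg_right (hw n j (bot n)) (sub_nonneg.2 (htop n (bot n)))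
    linarith
  have hlow : ∀ n j, x n (bot n) ≤ x (n + 1) j := by
    intro n j
    have h1 : ∑ r, w n j r * x n (bot n) = x n (bot n) := by
      rw [← Finset.sum_mul, hw1, one_mul]
    rw [hx, ← h1]
    exact Finset.sum_le_sum fun r _ =>
      mul_le_mul_of_nonneg_left (hbot n r) (hδ.le.trans (hw n j r))
  have hδ1 : δ ≤ 1 := by
    obtain ⟨j⟩ := ‹Nonempty ι›
    rw [← hw1 0 j]
    exact (hw 0 j j).trans (Finset.single_le_sum (f := fun r => w 0 j r)
      (fun r _ => hδ.le.trans (hw 0 j r)) (Finset.mem_univ j))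
  set o : ℕ → ℝ := fun n => x n (top n) - x n (bot n) with ho
  have ho0 : ∀ n, 0 ≤ o n := fun n => sub_nonneg.2 (htop n (bot n))
  have hstep : ∀ n, o (n + 1) ≤ (1 - δ) * o n := fun n => by
    have h1 := hup n (top (n + 1))
    have h2 := hlow n (bot (n + 1))
    simp only [ho]
    linarith
  have hgeo : ∀ n, o n ≤ (1 - δ) ^ n * o 0 := by
    intro n
    induction n with
    | zero => simp
    | succ n ih =>
      rw [pow_succ']
      have := mul_le_mul_of_nonneg_left ih (sub_nonneg.2 hδ1)
      linarith [hstep n]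
  have ho_tend : Tendsto o atTop (𝓝 0) := by
    refine squeeze_zero ho0 hgeo ?_
    simpa using (tendsto_pow_atTop_nhds_zero_of_lt_one (sub_nonneg.2 hδ1)
      (by linarith : 1 - δ < 1)).mul_const (o 0)
  have hanti : Antitone fun n => x n (top n) := antitone_nat_of_succ_le fun n => by
    have := mul_nonneg hδ.le (ho0 n)
    have h2 := hup n (top (n + 1))
    simp only [ho] at this
    linarith
  have hmono : Monotone fun n => x n (bot n) := monotone_nat_of_le_succ fun n => hlow n _
  have hbdd : BddBelow (Set.range fun n => x n (top n)) := by
    refine ⟨x 0 (bot 0), ?_⟩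
    rintro _ ⟨n, rfl⟩
    exact (hmono (Nat.zero_le n)).trans (htop n (bot n))
  have htend := tendsto_atTop_ciInf hanti hbdd
  refine ⟨_, fun j => tendsto_of_tendsto_of_tendsto_of_le_of_le
    (g := fun n => x n (top n) - o n) (by simpa using htend.sub ho_tend) htend
    (fun n => ?_) fun n => htop n j⟩
  simp only [ho]
  linarith [hbot n j]

/-- If the sequences `w j` are, up to `t k`, eventually close to `x k`, and `t k → 0`, then they
have a common limit. -/
lemma exists_common_limit {ι E : Type*} [Nonempty ι] [PseudoEMetricSpace E] [CompleteSpace E]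
    (w : ι → ℕ → E) (x : ℕ → E) (t : ℕ → ℝ≥0∞) (r : ℕ → ι → ℕ → ℝ≥0∞)
    (ht : Tendsto t atTop (𝓝 0)) (hr : ∀ k j, Tendsto (r k j) atTop (𝓝 0))
    (h : ∀ k j d, edist (w j (k + d)) (x k) ≤ t k + r k j d) :
    ∃ f, ∀ j, Tendsto (w j) atTop (𝓝 f) := by
  have hev : ∀ k j (δ : ℝ≥0∞), 0 < δ → ∀ᶠ N in atTop, edist (w j N) (x k) ≤ t k + δ := by
    intro k j δ hδ
    have h1 := (hr k j).eventually (ge_mem_nhds hδ)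
    filter_upwards [(tendsto_sub_atTop_nat k).eventually h1, eventually_ge_atTop k] with N hN hk
    have := h k j (N - k)
    rw [Nat.add_sub_cancel' hk] at this
    exact this.trans (by gcongr)
  have hxx : ∀ k l, edist (x k) (x l) ≤ t k + t l := by
    intro k l
    refine ENNReal.le_of_forall_pos_le_add fun ε hε _ => ?_
    have hε2 : (0 : ℝ≥0∞) < (ε : ℝ≥0∞) / 2 := ENNReal.half_pos (by exact_mod_cast hε.ne')
    obtain ⟨j⟩ := ‹Nonempty ι›
    obtain ⟨N, h1, h2⟩ := ((hev k j _ hε2).and (hev l j _ hε2)).exists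
    calc edist (x k) (x l) ≤ edist (w j N) (x k) + edist (w j N) (x l) := edist_triangle_left _ _ _
      _ ≤ t k + ε / 2 + (t l + ε / 2) := add_le_add h1 h2
      _ = t k + t l + (ε / 2 + ε / 2) := by ring
      _ = _ := by rw [ENNReal.add_halves]
  have hcau : CauchySeq x := by
    refine EMetric.cauchySeq_iff.2 fun ε hε => ?_
    obtain ⟨N, hN⟩ := eventually_atTop.1 (ht.eventually (gt_mem_nhds (ENNReal.half_pos hε.ne')))
    refine ⟨N, fun m hm n hn => (hxx m n).trans_lt ?_⟩
    rw [← ENNReal.add_halves ε]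
    exact ENNReal.add_lt_add (hN m hm) (hN n hn)
  obtain ⟨f, hf⟩ := cauchySeq_tendsto_of_complete hcau
  refine ⟨f, fun j => ?_⟩
  rw [tendsto_iff_edist_tendsto_0, ENNReal.tendsto_nhds_zero]
  intro ε hε
  have h3 : (0 : ℝ≥0∞) < ε / 3 := ENNReal.div_pos hε.ne' (by simp)
  obtain ⟨k, hk1, hk2⟩ := ((ENNReal.tendsto_nhds_zero.1 ht _ h3).and
    (ENNReal.tendsto_nhds_zero.1 (tendsto_iff_edist_tendsto_0.1 hf) _ h3)).exists
  filter_upwards [hev k j _ h3] with N hN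
  calc edist (w j N) f ≤ edist (w j N) (x k) + edist (x k) f := edist_triangle _ _ _
    _ ≤ t k + ε / 3 + edist (x k) f := by gcongr
    _ ≤ ε / 3 + ε / 3 + ε / 3 := by gcongr
    _ = ε := ENNReal.add_thirds ε

lemma eLpNorm_two_le {Ω : Type*} [MeasurableSpace Ω] {μ : Measure Ω} {f : Ω → ℝ} {c : ℝ≥0∞}
    (h : ∫⁻ ω, ENNReal.ofReal (f ω ^ 2) ∂μ ≤ c) : eLpNorm f 2 μ ≤ c ^ (1 / 2 : ℝ) := by
  rw [eLpNorm_eq_lintegral_rpow_enorm_toReal two_ne_zero ENNReal.ofNat_ne_top,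
    ENNReal.toReal_ofNat]
  refine ENNReal.rpow_le_rpow (le_trans (le_of_eq (lintegral_congr fun ω => ?_)) h) (by norm_num)
  rw [← sq_abs, ← Real.norm_eq_abs, ENNReal.ofReal_pow (norm_nonneg _), ofReal_norm,
    ENNReal.rpow_ofNat]

/-! ### L² convergence of the normalized process. -/

section Normalized

variable {p : ℕ} {Ω : Type*} {g : ℕ → OffspringLaw p} {ξ : ℕ → ℕ → Ω → Fin p → Fin p → ℕ}

lemma normalized_eq (n : ℕ) (i j : Fin p) (ω : Ω) :
    normalized g ξ n i j ω = ∑ r, (gwProcess ξ n ω i r : ℝ) *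
      (Pi.single j (1 / colNorm (meanProd g n) j) : Fin p → ℝ) r := by
  rw [Finset.sum_eq_single j (fun r _ hr => by rw [Pi.single_eq_of_ne hr, mul_zero])
    (fun h => absurd (Finset.mem_univ j) h), Pi.single_eq_same, normalized, mul_one_div]

lemma normalized_nonneg (n : ℕ) (i j : Fin p) (ω : Ω) : 0 ≤ normalized g ξ n i j ω :=
  div_nonneg (Nat.cast_nonneg _) (colNorm_nonneg _ _)

end Normalized

section L2

variable {p : ℕ} {Ω : Type*} [MeasurableSpace Ω] {μ : Measure Ω} {g : ℕ → OffspringLaw p}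
  {ξ : ℕ → ℕ → Ω → Fin p → Fin p → ℕ} {B ε K : ℝ}

/-- The product `M_{k,k+d} = M_{g_k} ⋯ M_{g_{k+d-1}}`. -/
noncomputable def meanProdFrom (g : ℕ → OffspringLaw p) (k : ℕ) : ℕ → Matrix (Fin p) (Fin p) ℝ
  | 0 => 1
  | d + 1 => meanProdFrom g k d * meanMatrix (g (k + d))

/-- The ratio in column `j` at step `d + 1` is an average of the ratios at step `d`, with weights
`v_{k+d}(r) M(r,j) / v_{k+d+1}(j)`. Comparability of the `v` and of the entries of `M` bounds each
weight below by `1 / (p * B ^ 2)`. -/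
lemma exists_tendsto_meanProdFrom (hB : 1 < B) (hM : ∀ n, meanMatrix (g n) ∈ SPlus p B)
    (k : ℕ) (i : Fin p) :
    ∃ h, ∀ j, Tendsto (fun d => meanProdFrom g k d i j / colNorm (meanProd g (k + d)) j)
      atTop (𝓝 h) := by
  have hp := i.pos
  have hp' : (0 : ℝ) < p := by exact_mod_cast hp
  have : Nonempty (Fin p) := ⟨i⟩
  have hv : ∀ n j, 0 < colNorm (meanProd g n) j := colNorm_pos hM
  refine exists_tendsto_of_averaging
    (fun d j => meanProdFrom g k d i j / colNorm (meanProd g (k + d)) j)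
    (fun d j r => colNorm (meanProd g (k + d)) r * meanMatrix (g (k + d)) r j /
      colNorm (meanProd g (k + d + 1)) j) (δ := 1 / (p * B ^ 2)) (by positivity) ?_ ?_ ?_
  · intro d j r
    rw [div_le_div_iff₀ (by positivity) (hv _ _), one_mul, colNorm_succ hM]
    refine (Finset.sum_le_sum (g := fun _ => colNorm (meanProd g (k + d)) r *
      meanMatrix (g (k + d)) r j * B ^ 2) fun l _ => ?_).trans (le_of_eq ?_)
    · have h1 := colNorm_le_mul hB hM (k + d) l r
      have h2 := meanMatrix_le_mul hM (k + d) l j r j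
      calc _ ≤ (B * colNorm (meanProd g (k + d)) r) * (B * meanMatrix (g (k + d)) r j) :=
            mul_le_mul h1 h2 ((hM _).1 _ _).le ((hv _ _).le.trans h1)
        _ = _ := by ring
    · simp; ring
  · intro d j
    rw [← Finset.sum_div, ← colNorm_succ hM, div_self (hv _ _).ne']
  · intro d j
    change (meanProdFrom g k d * meanMatrix (g (k + d))) i j /
      colNorm (meanProd g (k + d + 1)) j = _
    rw [Matrix.mul_apply, Finset.sum_div]
    refine Finset.sum_congr rfl fun r _ => ?_
    have := (hv (k + d) r).ne'
    field_simp

/-- Removing the last generation replaces `b` by `M b` at the cost of one variance term and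
preserves the normalization `hb1`, whence the general vector `b`. That normalization gives `b j ≤ p
B / m_{n+1}`; with `E|Z_n| ≤ m_n ≤ m_{n+1} / (2ε)` each term is of order `1 / m_{n+1}`. -/
lemma lintegral_sq_increment_le [IsProbabilityMeasure μ] (hξ : IsOffspringFamily μ g ξ)
    (hB : 1 < B) (hε : 0 < ε) (hK : 0 < K) (hM : ∀ n, meanMatrix (g n) ∈ SPlus p B)
    (hG : ∀ n, g n ∈ GClass p ε K) (k : ℕ) (i : Fin p) (d : ℕ) {b : Fin p → ℝ}
    (hb : ∀ j, 0 ≤ b j) (hb1 : ∑ j, colNorm (meanProd g (k + d)) j * b j = 1) :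
    ∫⁻ ω, ENNReal.ofReal ((∑ j, (gwProcess ξ (k + d) ω i j : ℝ) * b j -
      ∑ j, (gwProcess ξ k ω i j : ℝ) * (meanProdFrom g k d).mulVec b j) ^ 2) ∂μ ≤
    ∑ l ∈ Finset.range d, ENNReal.ofReal ((p * B) ^ 2 * K / (2 * ε) *
      (1 / matNorm (meanProd g (l + k + 1)))) := by
  induction d generalizing b with
  | zero => simp [meanProdFrom]
  | succ d ih =>
    have hp := i.pos
    set m := matNorm (meanProd g (k + d + 1)) with hm
    have hm0 : 0 < m := matNorm_pos hp hM _
    have hbA : ∀ j, |b j| ≤ p * B / m := by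
      intro j
      rw [abs_of_nonneg (hb j), le_div_iff₀ hm0]
      have h1 := Finset.single_le_sum (f := fun j => colNorm (meanProd g (k + (d + 1))) j * b j)
        (fun j _ => mul_nonneg (colNorm_nonneg _ _) (hb j)) (Finset.mem_univ j)
      rw [hb1] at h1
      have h2 := mul_le_mul_of_nonneg_left (matNorm_le_mul hB hM (k + d + 1) j) (hb j)
      have h3 := mul_le_mul_of_nonneg_left h1 (show 0 ≤ p * B by positivity)
      simp only [← add_assoc] at h3
      linarith
    have hstep := lintegral_sq_succ_le hξ hK.le hM hG (Nat.le_add_right k d) i hbA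
      (fun u => -∑ j, (u j : ℝ) * (meanProdFrom g k (d + 1)).mulVec b j)
    have hb' : ∀ j, 0 ≤ (meanMatrix (g (k + d))).mulVec b j := fun j => by
      change 0 ≤ ∑ l, meanMatrix (g (k + d)) j l * b l
      exact Finset.sum_nonneg fun l _ => mul_nonneg ((hM _).1 j l).le (hb l)
    have ih := ih hb' (by
      have := sum_colNorm_mul_meanMatrix hM (k + d) b
      rw [add_assoc, hb1] at this
      exact this)
    rw [Matrix.mulVec_mulVec] at ih
    simp only [← sub_eq_add_neg] at hstep
    rw [← add_assoc]
    refine hstep.trans ?_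
    rw [Finset.sum_range_succ]
    refine add_le_add ih (ENNReal.ofReal_le_ofReal ?_)
    rw [show d + k + 1 = k + d + 1 by ring, ← hm]
    have h4 := mul_matNorm_le hp hε hM hG (k + d)
    rw [← hm] at h4
    have h5 : matNorm (meanProd g (k + d)) ≤ m / (2 * ε) := by
      rw [le_div_iff₀ (by positivity)]; linarith
    calc (p * B / m) ^ 2 * K * matNorm (meanProd g (k + d))
        ≤ (p * B / m) ^ 2 * K * (m / (2 * ε)) := by gcongr
      _ = _ := by field_simp

lemma measurable_gwProcess_dot (hξ : IsOffspringFamily μ g ξ) (n : ℕ) (i : Fin p)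
    (a : Fin p → ℝ) : Measurable fun ω => ∑ j, (gwProcess ξ n ω i j : ℝ) * a j :=
  (Measurable.of_discrete (f := fun z : Fin p → ℕ => ∑ j, (z j : ℝ) * a j)).comp
    (measurable_gwProcess (fun m _ k => hξ.measurable m k) i)

lemma memLp_normalized [IsProbabilityMeasure μ] (hξ : IsOffspringFamily μ g ξ)
    (hK : 0 < K) (hM : ∀ n, meanMatrix (g n) ∈ SPlus p B)
    (hG : ∀ n, g n ∈ GClass p ε K) (n : ℕ) (i j : Fin p) :
    MemLp (normalized g ξ n i j) 2 μ := by
  rw [funext (normalized_eq n i j)]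
  exact memLp_gwProcess_dot hξ hK.le hM hG n i _

lemma exists_L2_limit [IsProbabilityMeasure μ] (hξ : IsOffspringFamily μ g ξ)
    (hB : 1 < B) (hε : 0 < ε) (hK : 0 < K) (hM : ∀ n, meanMatrix (g n) ∈ SPlus p B)
    (hG : ∀ n, g n ∈ GClass p ε K)
    (hsum : Summable fun n => 1 / matNorm (meanProd g (n + 1))) (i : Fin p) :
    ∃ f : Lp ℝ 2 μ, ∀ j,
      Tendsto (fun n => (memLp_normalized hξ hK hM hG n i j).toLp (normalized g ξ n i j))
        atTop (𝓝 f) := by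
  have hp := i.pos
  have : Nonempty (Fin p) := ⟨i⟩
  choose h hh using fun (k : ℕ) (i : Fin p) => exists_tendsto_meanProdFrom hB hM k i
  set C := (p * B) ^ 2 * K / (2 * ε) with hC
  have hC0 : 0 ≤ C := by positivity
  set f : ℕ → ℝ≥0∞ := fun l => ENNReal.ofReal (C * (1 / matNorm (meanProd g (l + 1)))) with hf
  set a : ℕ → Fin p → ℕ → Fin p → ℝ := fun k j d r =>
    meanProdFrom g k d r j / colNorm (meanProd g (k + d)) j with ha
  have hX : ∀ k, MemLp (fun ω => ∑ j, (gwProcess ξ k ω i j : ℝ) * h k j) 2 μ :=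
    fun k => memLp_gwProcess_dot hξ hK.le hM hG k i _
  -- The first error is the tail of the variance series, uniform in `d`; the second comes from
  -- replacing `a k j d` by its limit `h k`, and vanishes as `d → ∞` for fixed `k`.
  refine exists_common_limit _ (fun k => (hX k).toLp _) (fun k => (∑' l, f (l + k)) ^ (1 / 2 : ℝ))
    (fun k j d => ENNReal.ofReal (∑ r, |a k j d r - h k r|) *
      eLpNorm (fun ω => ∑ r, (gwProcess ξ k ω i r : ℝ) * 1) 2 μ) ?_ ?_ ?_
  · have hfs : ∑' l, f l ≠ ∞ := by
      refine ENNReal.tsum_coe_ne_top_iff_summable.2 ?_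
      exact (hsum.mul_left C).toNNReal
    have := (ENNReal.continuous_rpow_const (y := (1 / 2 : ℝ))).tendsto 0
    rw [ENNReal.zero_rpow_of_pos (by norm_num)] at this
    exact this.comp (ENNReal.tendsto_sum_nat_add f hfs)
  · intro k j
    have h1 : Tendsto (fun d => ∑ r, |a k j d r - h k r|) atTop (𝓝 0) := by
      have : Tendsto (fun d => ∑ r, |a k j d r - h k r|) atTop (𝓝 (∑ r : Fin p, |h k r - h k r|)) :=
        tendsto_finsetSum _ fun r _ => ((hh k r j).sub_const _).abs
      simpa using this
    have h2 := ENNReal.tendsto_ofReal h1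
    rw [ENNReal.ofReal_zero] at h2
    have h3 := ENNReal.Tendsto.mul_const h2
      (Or.inr (memLp_gwProcess_dot hξ hK.le hM hG k i fun _ => 1).eLpNorm_ne_top)
    rwa [zero_mul] at h3
  · intro k j d
    rw [Lp.edist_toLp_toLp]
    have hv := colNorm_pos hM (k + d) j
    set e : Fin p → ℝ := Pi.single j (1 / colNorm (meanProd g (k + d)) j) with he
    have hea : (meanProdFrom g k d).mulVec e = a k j d := by
      ext r
      rw [he, Matrix.mulVec_single]
      simp [ha, div_eq_mul_inv]
    have he0 : ∀ r, 0 ≤ e r := fun r => by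
      rw [he]
      by_cases hr : r = j
      · subst hr; rw [Pi.single_eq_same]; positivity
      · rw [Pi.single_eq_of_ne hr]
    have he1 : ∑ r, colNorm (meanProd g (k + d)) r * e r = 1 := by
      rw [Finset.sum_eq_single j (fun r _ hr => by rw [he, Pi.single_eq_of_ne hr, mul_zero])
        (fun h => absurd (Finset.mem_univ j) h), he, Pi.single_eq_same]
      field_simp
    have hinc := lintegral_sq_increment_le hξ hB hε hK hM hG k i d he0 he1
    rw [hea] at hinc
    have hinc2 := eLpNorm_two_le (hinc.trans (ENNReal.sum_le_tsum (f := fun l => f (l + k)) _))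
    set Y : Ω → ℝ := fun ω => ∑ r, (gwProcess ξ k ω i r : ℝ) * a k j d r with hY
    have hdec : normalized g ξ (k + d) i j - (fun ω => ∑ j, (gwProcess ξ k ω i j : ℝ) * h k j) =
        (fun ω => ∑ r, (gwProcess ξ (k + d) ω i r : ℝ) * e r - Y ω) +
          fun ω => ∑ r, (gwProcess ξ k ω i r : ℝ) * (a k j d r - h k r) := by
      ext ω
      simp only [Pi.sub_apply, Pi.add_apply, normalized_eq, hY, mul_sub, Finset.sum_sub_distrib, he]
      ring
    rw [hdec]
    refine (eLpNorm_add_le ((measurable_gwProcess_dot hξ _ i e).sub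
      (measurable_gwProcess_dot hξ k i _)).aestronglyMeasurable
      (measurable_gwProcess_dot hξ k i _).aestronglyMeasurable (by norm_num)).trans ?_
    refine add_le_add hinc2 ?_
    refine eLpNorm_le_mul_eLpNorm_of_ae_le_mul (ae_of_all _ fun ω => ?_) 2
    simp only [mul_one, Real.norm_eq_abs]
    rw [abs_of_nonneg (Finset.sum_nonneg fun r _ => Nat.cast_nonneg _ :
      (0 : ℝ) ≤ ∑ r, (gwProcess ξ k ω i r : ℝ)), Finset.mul_sum]
    refine (Finset.abs_sum_le_sum_abs _ _).trans (Finset.sum_le_sum fun r _ => ?_)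
    rw [abs_mul, Nat.abs_cast, mul_comm]
    exact mul_le_mul_of_nonneg_right (Finset.single_le_sum (f := fun r => |a k j d r - h k r|)
      (fun _ _ => abs_nonneg _) (Finset.mem_univ r)) (Nat.cast_nonneg _)

lemma exists_isL2Limit [IsProbabilityMeasure μ] (hξ : IsOffspringFamily μ g ξ)
    (hB : 1 < B) (hε : 0 < ε) (hK : 0 < K) (hM : ∀ n, meanMatrix (g n) ∈ SPlus p B)
    (hG : ∀ n, g n ∈ GClass p ε K)
    (hsum : Summable fun n => 1 / matNorm (meanProd g (n + 1))) :
    ∃ W : Fin p → Ω → ℝ, (∀ i, Measurable (W i)) ∧ (∀ i ω, 0 ≤ W i ω) ∧ IsL2Limit μ g ξ W := by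
  choose f hf using exists_L2_limit hξ hB hε hK hM hG hsum
  -- The positive part is nonnegative everywhere, and since the normalized process is nonnegative,
  -- taking it does not increase the L² distance.
  refine ⟨fun i ω => max (f i ω) 0, fun i => (Lp.stronglyMeasurable (f i)).measurable.max
    measurable_const, fun i ω => le_max_right _ _, fun i => (Lp.memLp (f i)).pos_part,
    fun i j => ?_⟩
  have h1 := (Lp.tendsto_Lp_iff_tendsto_eLpNorm' _ _).1 (hf i j)
  refine tendsto_of_tendsto_of_tendsto_of_le_of_le tendsto_const_nhds h1 (fun n => zero_le)
    fun n => ?_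
  refine eLpNorm_mono_ae ?_
  filter_upwards [(memLp_normalized hξ hK hM hG n i j).coeFn_toLp] with ω hω
  rw [Pi.sub_apply, hω, Real.norm_eq_abs, Real.norm_eq_abs]
  have h0 := normalized_nonneg (g := g) (ξ := ξ) n i j ω
  have h2 : max (normalized g ξ n i j ω) 0 = normalized g ξ n i j ω := max_eq_left h0
  calc _ = |max (normalized g ξ n i j ω) 0 - max (f i ω) 0| := by rw [h2]
    _ ≤ _ := abs_max_sub_max_le_abs _ _ _

end L2

/-! ### Extinction as absorption at zero. -/

section Absorption

variable {p : ℕ} {Ω : Type*} {ξ : ℕ → ℕ → Ω → Fin p → Fin p → ℕ} {ω : Ω} {i : Fin p}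

lemma popSize_eq_zero_iff {n : ℕ} : popSize ξ n ω i = 0 ↔ ∀ j, gwProcess ξ n ω i j = 0 := by
  simp [popSize]

lemma popSize_succ_eq_zero {n : ℕ} (h : popSize ξ n ω i = 0) : popSize ξ (n + 1) ω i = 0 := by
  rw [popSize_eq_zero_iff] at h ⊢
  intro j
  rw [gwProcess_succ]
  simp [offspringSum, h]

lemma popSize_eq_zero_of_le {m n : ℕ} (hmn : m ≤ n) (h : popSize ξ m ω i = 0) :
    popSize ξ n ω i = 0 := by
  induction n, hmn using Nat.le_induction with
  | base => exact h
  | succ n _ ih => exact popSize_succ_eq_zero ih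

/-- Sizes are integers, so a sequence that avoids `0` has liminf at least `1`; conversely `0` is
absorbing. -/
lemma liminf_popSize_eq_zero_iff :
    liminf (fun n => (popSize ξ n ω i : ℕ∞)) atTop = 0 ↔ ∃ n, popSize ξ n ω i = 0 := by
  constructor
  · intro h
    by_contra! hne
    have : (1 : ℕ∞) ≤ liminf (fun n => (popSize ξ n ω i : ℕ∞)) atTop :=
      le_liminf_of_le (h := Eventually.of_forall fun n => by
        exact_mod_cast Nat.one_le_iff_ne_zero.2 (hne n))
    rw [h] at this
    exact absurd this (by simp)
  · rintro ⟨n, hn⟩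
    rw [liminf_congr (v := fun _ => (0 : ℕ∞))
      ((eventually_ge_atTop n).mono fun m hm => by rw [popSize_eq_zero_of_le hm hn]; rfl)]
    simp

end Absorption

/-- If `y > δ`, then `x ≥ δ ^ k` and the last term is at least `1`. This linearizes the comparison
`y ^ k ≤ x` so that it can be integrated. -/
lemma le_add_div_pow {x y δ : ℝ} {k : ℕ} (hy0 : 0 ≤ y) (hy1 : y ≤ 1) (hδ : 0 < δ)
    (h : y ^ k ≤ x) : y ≤ δ + 1 / δ ^ k * x := by
  have hδk : 0 < δ ^ k := pow_pos hδ k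
  have hx : 0 ≤ x := (pow_nonneg hy0 k).trans h
  rcases le_total y δ with hyδ | hyδ
  · have : 0 ≤ 1 / δ ^ k * x := by positivity
    linarith
  · have h1 : δ ^ k ≤ x := (pow_le_pow_left₀ hδ.le hyδ k).trans h
    have h2 : 1 ≤ 1 / δ ^ k * x := by
      rw [one_div_mul_eq_div, le_div_iff₀ hδk]
      linarith
    linarith

/-! ### The limit vanishes exactly on extinction, up to a null set. -/

section Extinction

variable {p : ℕ} {Ω : Type*} [MeasurableSpace Ω] {μ : Measure Ω} {g : ℕ → OffspringLaw p}
  {ξ : ℕ → ℕ → Ω → Fin p → Fin p → ℕ} {B ε K : ℝ}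

lemma measurable_comp_gwProcess {β : Type*} [MeasurableSpace β] (hξ : IsOffspringFamily μ g ξ)
    (n : ℕ) (i : Fin p) (f : (Fin p → ℕ) → β) : Measurable fun ω => f (gwProcess ξ n ω i) :=
  Measurable.of_discrete.comp (measurable_gwProcess (fun m _ k => hξ.measurable m k) i)

lemma measurableSet_popSize_eq_zero (hξ : IsOffspringFamily μ g ξ) (n : ℕ) (i : Fin p) :
    MeasurableSet {ω | popSize ξ n ω i = 0} :=
  measurable_comp_gwProcess hξ n i (fun z => ∑ j, z j) (measurableSet_singleton 0)

lemma lintegral_prod_markIter_one [IsProbabilityMeasure μ] (hξ : IsOffspringFamily μ g ξ)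
    (n d : ℕ) (i : Fin p) :
    ∫⁻ ω, ENNReal.ofReal (∏ j, (1 - markIter g n d (fun _ => 1) j) ^ gwProcess ξ n ω i j) ∂μ =
      μ {ω | popSize ξ (n + d) ω i = 0} := by
  rw [← lintegral_prod_one_sub_pow hξ (fun _ => by simp) n d i,
    ← lintegral_indicator_one (measurableSet_popSize_eq_zero hξ (n + d) i)]
  refine lintegral_congr fun ω => ?_
  by_cases h : popSize ξ (n + d) ω i = 0
  · rw [Set.indicator_of_mem (show ω ∈ {ω | popSize ξ (n + d) ω i = 0} from h)]
    rw [popSize_eq_zero_iff] at h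
    simp [h]
  · rw [Set.indicator_of_notMem (show ω ∉ {ω | popSize ξ (n + d) ω i = 0} from h)]
    rw [popSize_eq_zero_iff] at h
    push Not at h
    obtain ⟨j, hj⟩ := h
    rw [Finset.prod_eq_zero (Finset.mem_univ j) (by simp [hj]), ENNReal.ofReal_zero]

/-- The integrand is the conditional probability, given `Z_n`, of extinction by time `n + d`. Off
the event of extinction by time `n`, it integrates to the probability of dying out between the two
times. -/
lemma setLIntegral_survival_le [IsProbabilityMeasure μ] (hξ : IsOffspringFamily μ g ξ)
    (n d : ℕ) (i : Fin p) :
    ∫⁻ ω in {ω | popSize ξ n ω i = 0}ᶜ,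
      ENNReal.ofReal (∏ j, (1 - markIter g n d (fun _ => 1) j) ^ gwProcess ξ n ω i j) ∂μ ≤
      extinctionProb μ ξ i - μ {ω | popSize ξ n ω i = 0} := by
  set E := {ω | popSize ξ n ω i = 0} with hE
  have hEm : MeasurableSet E := measurableSet_popSize_eq_zero hξ n i
  set X : Ω → ℝ≥0∞ := fun ω =>
    ENNReal.ofReal (∏ j, (1 - markIter g n d (fun _ => 1) j) ^ gwProcess ξ n ω i j) with hX
  have h1 : ∫⁻ ω in E, X ω ∂μ = μ E := by
    rw [← setLIntegral_one]
    refine setLIntegral_congr_fun hEm fun ω hω => ?_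
    have hω' : ∀ j, gwProcess ξ n ω i j = 0 := popSize_eq_zero_iff.1 hω
    simp [hX, hω']
  have h2 : ∫⁻ ω, X ω ∂μ ≤ extinctionProb μ ξ i := by
    rw [hX, lintegral_prod_markIter_one hξ]
    exact measure_mono fun ω hω => ⟨n + d, hω⟩
  rw [← lintegral_add_compl X hEm, h1] at h2
  exact ENNReal.le_sub_of_add_le_left (measure_ne_top _ _) h2

/-- The exponential is the probability that no particle is marked when type `j` carries marks of
intensity `lam / v_{n+d}(j)`. Conditioning on generation `n` and using `hk` particle by particle
compares it with the conditional probability of extinction. -/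
lemma lintegral_exp_neg_normalized_le [IsProbabilityMeasure μ] (hξ : IsOffspringFamily μ g ξ)
    (hM : ∀ n, meanMatrix (g n) ∈ SPlus p B) (i j : Fin p) {k : ℕ} {n d : ℕ} {lam : ℝ}
    (hlam : 0 ≤ lam)
    (hk : ∀ r : Fin p, (1 - markIter g n d (Pi.single j (1 - Real.exp
        (-(lam / colNorm (meanProd g (n + d)) j)))) r) ^ k ≤
      1 - markIter g n d (fun _ => 1) r) {δ : ℝ} (hδ : 0 < δ) :
    ∫⁻ ω, ENNReal.ofReal (Real.exp (-(lam * normalized g ξ (n + d) i j ω))) ∂μ ≤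
      μ {ω | popSize ξ n ω i = 0} + ENNReal.ofReal δ + ENNReal.ofReal (1 / δ ^ k) *
        (extinctionProb μ ξ i - μ {ω | popSize ξ n ω i = 0}) := by
  set vN := colNorm (meanProd g (n + d)) j with hvN
  have hvN0 : 0 < vN := colNorm_pos hM _ _
  set u₀ : Fin p → ℝ := Pi.single j (1 - Real.exp (-(lam / vN))) with hu₀
  have hu : ∀ i, u₀ i ∈ Set.Icc (0 : ℝ) 1 := by
    intro i
    by_cases h : i = j
    · subst h
      rw [hu₀, Pi.single_eq_same]
      exact ⟨by linarith [Real.exp_le_one_iff.2 (neg_nonpos.2 (div_nonneg hlam hvN0.le))],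
        by linarith [Real.exp_pos (-(lam / vN))]⟩
    · rw [hu₀, Pi.single_eq_of_ne h]; simp
  have h1 : ∀ ω, Real.exp (-(lam * normalized g ξ (n + d) i j ω)) =
      ∏ r, (1 - u₀ r) ^ gwProcess ξ (n + d) ω i r := by
    intro ω
    rw [Finset.prod_eq_single j
      (fun r _ hr => by rw [hu₀, Pi.single_eq_of_ne hr, sub_zero, one_pow])
      (fun h => absurd (Finset.mem_univ j) h), hu₀, Pi.single_eq_same, sub_sub_cancel,
      ← Real.exp_nat_mul, normalized]
    congr 1
    ring
  simp_rw [h1]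
  rw [lintegral_prod_one_sub_pow hξ hu n d i]
  set E := {ω | popSize ξ n ω i = 0} with hE
  have hEm : MeasurableSet E := measurableSet_popSize_eq_zero hξ n i
  have hu01 := markIter_mem (g := g) hu n d
  have hs01 := markIter_mem (g := g) (s := fun _ => 1) (fun _ => by simp) n d
  set Y : Ω → ℝ := fun ω => ∏ r, (1 - markIter g n d u₀ r) ^ gwProcess ξ n ω i r with hY
  set X : Ω → ℝ := fun ω => ∏ r, (1 - markIter g n d (fun _ => 1) r) ^ gwProcess ξ n ω i r with hX
  have hXm : Measurable X := measurable_comp_gwProcess hξ n i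
    fun z => ∏ r, (1 - markIter g n d (fun _ => 1) r) ^ z r
  have hY01 : ∀ ω, Y ω ∈ Set.Icc (0 : ℝ) 1 := fun ω => prod_one_sub_pow_mem hu01 _
  have hYX : ∀ ω, Y ω ≤ δ + 1 / δ ^ k * X ω := by
    intro ω
    refine le_add_div_pow (hY01 ω).1 (hY01 ω).2 hδ ?_
    rw [hY, ← Finset.prod_pow]
    refine Finset.prod_le_prod
      (fun r _ => pow_nonneg (pow_nonneg (by linarith [(hu01 r).2]) _) _) fun r _ => ?_
    rw [pow_right_comm]
    exact pow_le_pow_left₀ (pow_nonneg (by linarith [(hu01 r).2]) _) (hk r) _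
  have hδk : 0 ≤ 1 / δ ^ k := by positivity
  calc ∫⁻ ω, ENNReal.ofReal (Y ω) ∂μ
      = ∫⁻ ω in E, ENNReal.ofReal (Y ω) ∂μ + ∫⁻ ω in Eᶜ, ENNReal.ofReal (Y ω) ∂μ :=
        (lintegral_add_compl _ hEm).symm
    _ ≤ ∫⁻ ω in E, 1 ∂μ + ∫⁻ ω in Eᶜ, (ENNReal.ofReal δ +
          ENNReal.ofReal (1 / δ ^ k) * ENNReal.ofReal (X ω)) ∂μ := by
        refine add_le_add (lintegral_mono fun ω => ENNReal.ofReal_le_one.2 (hY01 ω).2)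
          (lintegral_mono fun ω => ?_)
        rw [← ENNReal.ofReal_mul hδk, ← ENNReal.ofReal_add hδ.le
          (mul_nonneg hδk (prod_one_sub_pow_mem hs01 _).1)]
        exact ENNReal.ofReal_le_ofReal (hYX ω)
    _ ≤ μ E + (ENNReal.ofReal δ + ENNReal.ofReal (1 / δ ^ k) *
          (extinctionProb μ ξ i - μ E)) := by
        rw [setLIntegral_one, lintegral_add_left measurable_const, setLIntegral_const,
          lintegral_const_mul _ hXm.ennreal_ofReal]
        gcongr
        · exact mul_le_of_le_one_right' prob_le_one
        · exact setLIntegral_survival_le hξ n d i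
    _ = _ := (add_assoc _ _ _).symm

lemma tendsto_measure_popSize_eq_zero (μ : Measure Ω) (ξ : ℕ → ℕ → Ω → Fin p → Fin p → ℕ)
    (i : Fin p) : Tendsto (fun n => μ {ω | popSize ξ n ω i = 0}) atTop
      (𝓝 (extinctionProb μ ξ i)) := by
  have : {ω | ∃ n, popSize ξ n ω i = 0} = ⋃ n, {ω | popSize ξ n ω i = 0} := by
    ext ω; simp
  rw [extinctionProb, this]
  exact tendsto_measure_iUnion_atTop fun m n hmn ω hω => popSize_eq_zero_of_le hmn hω

lemma exists_seq_tendsto_ae_of_isL2Limit [IsProbabilityMeasure μ] (hξ : IsOffspringFamily μ g ξ)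
    (hK : 0 < K) (hM : ∀ n, meanMatrix (g n) ∈ SPlus p B)
    (hG : ∀ n, g n ∈ GClass p ε K) {W : Fin p → Ω → ℝ} (hW : IsL2Limit μ g ξ W) (i j : Fin p) :
    ∃ ns : ℕ → ℕ, StrictMono ns ∧
      ∀ᵐ ω ∂μ, Tendsto (fun m => normalized g ξ (ns m) i j ω) atTop (𝓝 (W i ω)) :=
  (tendstoInMeasure_of_tendsto_eLpNorm two_ne_zero
    (fun n => (memLp_normalized hξ hK hM hG n i j).aestronglyMeasurable)
    (hW.1 i).aestronglyMeasurable (hW.2 i j)).exists_seq_tendsto_ae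

lemma extinctionProb_le_measure_limit_eq_zero [IsProbabilityMeasure μ]
    (hξ : IsOffspringFamily μ g ξ)
    (hK : 0 < K) (hM : ∀ n, meanMatrix (g n) ∈ SPlus p B)
    (hG : ∀ n, g n ∈ GClass p ε K) {W : Fin p → Ω → ℝ} (hW : IsL2Limit μ g ξ W) (i : Fin p) :
    extinctionProb μ ξ i ≤ μ {ω | W i ω = 0} := by
  obtain ⟨ns, hns, hae⟩ := exists_seq_tendsto_ae_of_isL2Limit hξ hK hM hG hW i i
  refine measure_mono_ae ?_
  filter_upwards [hae] with ω hω hext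
  obtain ⟨n, hn⟩ := hext
  refine tendsto_nhds_unique hω (tendsto_const_nhds.congr' ?_)
  filter_upwards [hns.tendsto_atTop.eventually_ge_atTop n] with m hm
  rw [normalized, popSize_eq_zero_iff.1 (popSize_eq_zero_of_le hm hn) i]
  simp

/-- The Laplace parameter `lam` depends on `n` only, so it stays fixed while the later generation
tends to infinity along an almost surely convergent subsequence; on `W i = 0` the exponential tends
to `1`, and Fatou's lemma applies. -/
lemma measure_limit_eq_zero_le [IsProbabilityMeasure μ] (hξ : IsOffspringFamily μ g ξ)
    (hB : 1 < B) (hε : 0 < ε) (hK : 0 < K) (hM : ∀ n, meanMatrix (g n) ∈ SPlus p B)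
    (hG : ∀ n, g n ∈ GClass p ε K) {W : Fin p → Ω → ℝ} (hW : IsL2Limit μ g ξ W) (i : Fin p) :
    μ {ω | W i ω = 0} ≤ extinctionProb μ ξ i := by
  obtain ⟨ns, hns, hae⟩ := exists_seq_tendsto_ae_of_isL2Limit hξ hK hM hG hW i i
  obtain ⟨k, hk⟩ := exists_pow_markIter_le i.pos hB hε hK hM hG i
  set q := extinctionProb μ ξ i with hq
  have hqt : q ≠ ∞ := measure_ne_top _ _
  have key : ∀ (n : ℕ) (δ : ℝ), 0 < δ → μ {ω | W i ω = 0} ≤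
      μ {ω | popSize ξ n ω i = 0} + ENNReal.ofReal δ + ENNReal.ofReal (1 / δ ^ k) *
        (q - μ {ω | popSize ξ n ω i = 0}) := by
    intro n δ hδ
    set lam := matNorm (meanProd g (n + 1)) with hlam
    have hlam0 : 0 ≤ lam := (matNorm_pos i.pos hM _).le
    set F : ℕ → Ω → ℝ≥0∞ := fun m ω =>
      ENNReal.ofReal (Real.exp (-(lam * normalized g ξ (ns m) i i ω))) with hF
    have hFm : ∀ m, Measurable (F m) := fun m => measurable_comp_gwProcess hξ (ns m) i fun z =>
      ENNReal.ofReal (Real.exp (-(lam * (z i / colNorm (meanProd g (ns m)) i))))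
    calc μ {ω | W i ω = 0} ≤ μ {ω | 1 ≤ liminf (fun m => F m ω) atTop} := by
          refine measure_mono_ae ?_
          filter_upwards [hae] with ω hω hW0
          have hW0 : W i ω = 0 := hW0
          rw [hW0] at hω
          have h1 : Tendsto (fun m => F m ω) atTop
              (𝓝 (ENNReal.ofReal (Real.exp (-(lam * 0))))) :=
            ENNReal.tendsto_ofReal ((Real.continuous_exp.tendsto _).comp (hω.const_mul lam).neg)
          rw [mul_zero, neg_zero, Real.exp_zero, ENNReal.ofReal_one] at h1
          exact h1.liminf_eq.ge
      _ ≤ ∫⁻ ω, liminf (fun m => F m ω) atTop ∂μ := by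
          have := mul_meas_ge_le_lintegral (μ := μ) (Measurable.liminf hFm) 1
          rwa [one_mul] at this
      _ ≤ liminf (fun m => ∫⁻ ω, F m ω ∂μ) atTop := lintegral_liminf_le hFm
      _ ≤ _ := by
          refine liminf_le_of_frequently_le' (Eventually.frequently ?_)
          filter_upwards [hns.tendsto_atTop.eventually_ge_atTop (n + 1)] with m hm
          obtain ⟨d, hd⟩ := Nat.exists_eq_add_of_le hm
          -- The uniform comparison needs at least one generation between `n` and `ns m`.
          have hd' : ns m = n + (d + 1) := by omega
          simp only [hF, hd']
          exact lintegral_exp_neg_normalized_le hξ hM i i hlam0 (hk n d) hδ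
  refine ENNReal.le_of_forall_pos_le_add fun δ hδ _ => ?_
  -- With `δ` and `k` fixed, the probability of dying out after generation `n` tends to `0` and
  -- absorbs the large factor `1 / δ ^ k`; this is where `k` must not depend on `n`.
  have hlim : Tendsto (fun n => μ {ω | popSize ξ n ω i = 0} + ENNReal.ofReal (δ : ℝ) +
      ENNReal.ofReal (1 / (δ : ℝ) ^ k) * (q - μ {ω | popSize ξ n ω i = 0})) atTop
      (𝓝 (q + ENNReal.ofReal (δ : ℝ) + ENNReal.ofReal (1 / (δ : ℝ) ^ k) * (q - q))) := by
    have h1 := tendsto_measure_popSize_eq_zero μ ξ i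
    exact (h1.add tendsto_const_nhds).add (ENNReal.Tendsto.const_mul
      (ENNReal.Tendsto.sub tendsto_const_nhds h1 (Or.inl hqt)) (Or.inr ENNReal.ofReal_ne_top))
  rw [tsub_self, mul_zero, add_zero] at hlim
  rw [← ENNReal.ofReal_coe_nnreal]
  exact ge_of_tendsto' hlim fun n => key n δ (by exact_mod_cast hδ)

end Extinction

end MGW

theorem mainTheorem4 {p : ℕ} (hp : 2 ≤ p)
    {Ω : Type*} [MeasurableSpace Ω] (μ : Measure Ω) [IsProbabilityMeasure μ]
    (g : ℕ → MGW.OffspringLaw p) (ξ : ℕ → ℕ → Ω → Fin p → Fin p → ℕ)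
    (hξ : MGW.IsOffspringFamily μ g ξ)
    (B : ℝ) (hB : 1 < B) (hM : ∀ n, MGW.meanMatrix (g n) ∈ MGW.SPlus p B)
    (ε K : ℝ) (hε : 0 < ε) (hε1 : ε < 1) (hK : 0 < K) (hG : ∀ n, g n ∈ MGW.GClass p ε K)
    (hJones : ∃ i j : Fin p, Summable fun n : ℕ =>
      1 / MGW.matNorm (MGW.meanProd g n) *
        (MGW.offspringVar (g n) i j / MGW.matNorm (MGW.meanMatrix (g (n + 1))) ^ 2))
    (hMean : ∃ i j : Fin p, Summable fun n : ℕ => 1 / MGW.meanProd g (n + 1) i j) :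
    (∃ W : Fin p → Ω → ℝ, (∀ i, Measurable (W i)) ∧ (∀ i ω, 0 ≤ W i ω) ∧
      MGW.IsL2Limit μ g ξ W) ∧
    ∀ W : Fin p → Ω → ℝ, MGW.IsL2Limit μ g ξ W → ∀ i : Fin p,
      μ {ω | W i ω = 0} =
          μ {ω | liminf (fun n => (MGW.popSize ξ n ω i : ℕ∞)) atTop = 0} ∧
        μ {ω | liminf (fun n => (MGW.popSize ξ n ω i : ℕ∞)) atTop = 0} =
          MGW.extinctionProb μ ξ i := by
  refine ⟨MGW.exists_isL2Limit hξ hB hε hK hM hG (MGW.summable_inv_matNorm hM hMean),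
    fun W hW i => ?_⟩
  have hlim : μ {ω | liminf (fun n => (MGW.popSize ξ n ω i : ℕ∞)) atTop = 0} =
      MGW.extinctionProb μ ξ i := by
    simp_rw [MGW.liminf_popSize_eq_zero_iff]
    rfl
  rw [hlim]
  exact ⟨le_antisymm (MGW.measure_limit_eq_zero_le hξ hB hε hK hM hG hW i)
    (MGW.extinctionProb_le_measure_limit_eq_zero hξ hK hM hG hW i), rfl⟩
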